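/- Let $V$ be a vertex operator algebra over $\mathbb C$ with conformal vector $\omega$, and write $Y(\omega,x)=\sum_{n\in\mathbb Z}L(n)x^{-n-2}$ on $V$ and on every module. A $V$-module is a $\mathbb C$-graded space $W=\coprod_{n\in\mathbb C}W_{(n)}$ with $\dim W_{(n)}<\infty$ and $W_{(n)}=0$ when the real part of $n$ is sufficiently small, with a lower truncated action $Y(v,x)w=\sum_{n\in\mathbb Z}v_nw\,x^{-n-1}$ satisfying the vacuum property $Y(\mathbf 1,x)=1$, the Jacobi identity, the Virasoro relations (with the rank of $V$), $L(0)w=nw$ for $w\in W_{(n)}$, and $\frac{d}{dx}Y(v,x)=Y(L(-1)v,x)$. Its contragredient is $W'=\coprod_{n}W_{(n)}^*$ with $\langle Y'(v,x)w',w\rangle=\langle w',Y(e^{xL(1)}(-x^{-2})^{L(0)}v,x^{-1})w\rangle$; $W''$ is canonically identified with $W$. For $V$-modules $(W_1,Y_1),(W_2,Y_2),(W_3,Y_3)$, an intertwining operator of type $\binom{W_3}{W_1\,W_2}$ is a linear map $W_1\otimes W_2\to W_3\{x\}$, $w_{(1)}\otimes w_{(2)}\mapsto\mathcal Y(w_{(1)},x)w_{(2)}=\sum_{n\in\mathbb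 C}(w_{(1)})_nw_{(2)}\,x^{-n-1}$, such that $(w_{(1)})_nw_{(2)}=0$ for $n$ with sufficiently large real part, $\frac{d}{dx}\mathcal Y(w_{(1)},x)=\mathcal Y(L(-1)w_{(1)},x)$, and for $v\in V$ the Jacobi identity holds: $$x_0^{-1}\delta\!\left(\tfrac{x_1-x_2}{x_0}\right)Y_3(v,x_1)\mathcal Y(w_{(1)},x_2)w_{(2)}-x_0^{-1}\delta\!\left(\tfrac{x_2-x_1}{-x_0}\right)\mathcal Y(w_{(1)},x_2)Y_2(v,x_1)w_{(2)}=x_2^{-1}\delta\!\left(\tfrac{x_1-x_0}{x_2}\right)\mathcal Y(Y_1(v,x_0)w_{(1)},x_2)w_{(2)}.$$ These operators form a vector space $\mathcal V^{W_3}_{W_1W_2}$, whose dimension is denoted $N^{W_3}_{W_1W_2}$. For $r\in\mathbb Z$ the $r$-contragredient operator $A_r(\mathcal Y):W_1\otimes W_3'\to W_2'\{x\}$ of $\mathcal Y\in\mathcal V^{W_3}_{W_1W_2}$ is defined by $$\langle A_r(\mathcal Y)(w_{(1)},x)w'_{(3)},w_{(2)}\rangle_{W_2}=\langle w'_{(3)},\mathcal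 Y(e^{xL(1)}e^{(2r+1)\pi iL(0)}x^{-2L(0)}w_{(1)},x^{-1})w_{(2)}\rangle_{W_3}.$$ **Proposition.** Let $W_1,W_2,W_3$ be $V$-modules and $r\in\mathbb Z$. Then $W_2'$ and $W_3'$ are $V$-modules, and for every intertwining operator $\mathcal Y$ of type $\binom{W_3}{W_1\,W_2}$, the operator $A_r(\mathcal Y)$ is an intertwining operator of type $\binom{W_2'}{W_1\,W_3'}$. Moreover, $$A_{-r-1}(A_r(\mathcal Y))=A_r(A_{-r-1}(\mathcal Y))=\mathcal Y .$$ In particular, $\mathcal Y\mapsto A_r(\mathcal Y)$ is a linear isomorphism from $\mathcal V^{W_3}_{W_1W_2}$ to $\mathcal V^{W_2'}_{W_1W_3'}$, and $$N^{W_3}_{W_1W_2}=N^{W_2'}_{W_1W_3'} .$$ -/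

import Mathlib

open Module

noncomputable section

namespace VOA

/-! ### Formal vertex-type operators and the Jacobi identity

A linear map `W₁ ⊗ W₂ → W₃{x}`, `w₁ ⊗ w₂ ↦ ∑ₙ (w₁)ₙ w₂ x^(-n-1)`, is represented by its coefficients
`I n w₁ w₂ = (w₁)ₙ w₂`, a family of bilinear maps indexed by the exponents `n` (in `ℤ` for vertex
operators of algebras and modules, in `ℂ` for intertwining operators). -/

section Jacobi

variable {V W₁ W₂ W₃ : Type*} [AddCommGroup V] [Module ℂ V] [AddCommGroup W₁] [Module ℂ W₁]
  [AddCommGroup W₂] [Module ℂ W₂] [AddCommGroup W₃] [Module ℂ W₃]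

/-- The Jacobi identity
`x₀⁻¹ δ((x₁-x₂)/x₀) Y₃(v,x₁) I(w₁,x₂) w₂ - x₀⁻¹ δ((x₂-x₁)/(-x₀)) I(w₁,x₂) Y₂(v,x₁) w₂
  = x₂⁻¹ δ((x₁-x₀)/x₂) I(Y₁(v,x₀)w₁,x₂) w₂`,
where `δ(x) = ∑ xⁿ` and binomials are expanded in nonnegative integral powers of the second
variable. It is stated as the equality of the coefficients of `x₀^(-l-1) x₁^(-m-1) x₂^(-n-1)`,
for all integers `l`, `m` and all exponents `n`. All the sums are finite as soon as
the operators are lower truncated. -/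
def JacobiIdentity {κ : Type*} [AddGroupWithOne κ]
    (Y₁ : ℤ → V →ₗ[ℂ] W₁ →ₗ[ℂ] W₁) (Y₂ : ℤ → V →ₗ[ℂ] W₂ →ₗ[ℂ] W₂)
    (Y₃ : ℤ → V →ₗ[ℂ] W₃ →ₗ[ℂ] W₃) (I : κ → W₁ →ₗ[ℂ] W₂ →ₗ[ℂ] W₃) : Prop :=
  ∀ (v : V) (w₁ : W₁) (w₂ : W₂) (l m : ℤ) (n : κ),
    (∑ᶠ i : ℕ, ((-1 : ℂ) ^ i * ((Ring.choose l i : ℤ) : ℂ)) •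
        Y₃ (m + l - (i : ℤ)) v (I (n + (i : κ)) w₁ w₂))
      - (∑ᶠ i : ℕ, ((-1 : ℂ) ^ l * (-1 : ℂ) ^ i * ((Ring.choose l i : ℤ) : ℂ)) •
        I (n + (l : κ) - (i : κ)) w₁ (Y₂ (m + (i : ℤ)) v w₂))
      = ∑ᶠ i : ℕ, ((Ring.choose m i : ℤ) : ℂ) •
        I ((m : κ) + n - (i : κ)) (Y₁ (l + (i : ℤ)) v w₁) w₂

end Jacobi

/-! ### Vertex operator algebras and modules -/

/-- A vertex operator algebra structure on the complex vector space `V`;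
`Y n u v` is `uₙ v`, where `Y(u,x) v = ∑ₙ uₙ v x^(-n-1)`. -/
structure VertexOperatorAlgebra (V : Type*) [AddCommGroup V] [Module ℂ V] where
  /-- the weight spaces `V₍ₙ₎` -/
  gr : ℤ → Submodule ℂ V
  /-- the coefficients of the vertex operators -/
  Y : ℤ → V →ₗ[ℂ] V →ₗ[ℂ] V
  /-- the vacuum vector -/
  vac : V
  /-- the conformal vector -/
  ω : V
  /-- the rank (central charge) -/
  rank : ℂ
  internal : DirectSum.IsInternal gr
  finite : ∀ n, FiniteDimensional ℂ (gr n)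
  lower : ∃ N : ℤ, ∀ n < N, gr n = ⊥
  vac_mem : vac ∈ gr 0
  ω_mem : ω ∈ gr 2
  truncation : ∀ u v, ∃ N : ℤ, ∀ n ≥ N, Y n u v = 0
  vacuum : ∀ n v, Y n vac v = if n = -1 then v else 0
  creation : ∀ v, (∀ n ≥ 0, Y n v vac = 0) ∧ Y (-1) v vac = v
  jacobi : JacobiIdentity Y Y Y Y
  virasoro : ∀ (m n : ℤ) (v : V),
    Y (m + 1) ω (Y (n + 1) ω v) - Y (n + 1) ω (Y (m + 1) ω v) =
      ((m : ℂ) - n) • Y (m + n + 1) ω v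
        + (if m + n = 0 then ((m : ℂ) ^ 3 - m) / 12 * rank else 0) • v
  L_zero : ∀ n, ∀ v ∈ gr n, Y 1 ω v = (n : ℂ) • v
  L_neg_one_derivative : ∀ (n : ℤ) (u v : V), Y n (Y 0 ω u) v = -(n : ℂ) • Y (n - 1) u v

variable {V : Type*} [AddCommGroup V] [Module ℂ V]

/-- The underlying data of a module for a vertex operator algebra: a vector space with a `ℂ`-indexed
family of weight spaces and a lower truncated linear map `V ⊗ W → W[[x,x⁻¹]]`,
`Y(v,x) w = ∑ₙ vₙ w x^(-n-1)` with `Y n v w = vₙ w`. The module axioms are `GradedAction.IsModule`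
below. -/
structure GradedAction (𝒱 : VertexOperatorAlgebra V) (W : Type*) [AddCommGroup W] [Module ℂ W] where
  /-- the weight spaces `W₍ₙ₎` -/
  gr : ℂ → Submodule ℂ W
  /-- the coefficients of the vertex operators -/
  Y : ℤ → V →ₗ[ℂ] W →ₗ[ℂ] W
  truncation : ∀ v w, ∃ N : ℤ, ∀ n ≥ N, Y n v w = 0

variable {𝒱 : VertexOperatorAlgebra V}

/-- The operator `L(n) = ω₍ₙ₊₁₎` on `V`. -/
def VertexOperatorAlgebra.L (𝒱 : VertexOperatorAlgebra V) (n : ℤ) : V →ₗ[ℂ] V := 𝒱.Y (n + 1) 𝒱.ω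

/-- The operator `L(n) = ω₍ₙ₊₁₎` on `W`. -/
def GradedAction.L {W : Type*} [AddCommGroup W] [Module ℂ W] (M : GradedAction 𝒱 W) (n : ℤ) :
    W →ₗ[ℂ] W := M.Y (n + 1) 𝒱.ω

/-- `M` is a module for the vertex operator algebra `𝒱`. -/
structure GradedAction.IsModule {W : Type*} [AddCommGroup W] [Module ℂ W]
    (M : GradedAction 𝒱 W) : Prop where
  internal : DirectSum.IsInternal M.gr
  finite : ∀ n, FiniteDimensional ℂ (M.gr n)
  lower : ∃ N : ℝ, ∀ n : ℂ, n.re < N → M.gr n = ⊥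
  vacuum : ∀ n w, M.Y n 𝒱.vac w = if n = -1 then w else 0
  jacobi : JacobiIdentity 𝒱.Y M.Y M.Y M.Y
  virasoro : ∀ (m n : ℤ) (w : W),
    M.L m (M.L n w) - M.L n (M.L m w) =
      ((m : ℂ) - n) • M.L (m + n) w
        + (if m + n = 0 then ((m : ℂ) ^ 3 - m) / 12 * 𝒱.rank else 0) • w
  L_zero : ∀ n, ∀ w ∈ M.gr n, M.L 0 w = n • w
  L_neg_one_derivative : ∀ (n : ℤ) (v : V) (w : W),
    M.Y n (𝒱.L (-1) v) w = -(n : ℂ) • M.Y (n - 1) v w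

/-! ### Intertwining operators -/

section Intertwining

variable {W₁ W₂ W₃ : Type*} [AddCommGroup W₁] [Module ℂ W₁] [AddCommGroup W₂] [Module ℂ W₂]
  [AddCommGroup W₃] [Module ℂ W₃]

/-- `I` is an intertwining operator of type `(W₃; W₁ W₂)`. -/
structure IsIntertwiningOperator (M₁ : GradedAction 𝒱 W₁) (M₂ : GradedAction 𝒱 W₂)
    (M₃ : GradedAction 𝒱 W₃) (I : ℂ → W₁ →ₗ[ℂ] W₂ →ₗ[ℂ] W₃) : Prop where
  truncation : ∀ w₁ w₂, ∃ N : ℝ, ∀ n : ℂ, N ≤ n.re → I n w₁ w₂ = 0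
  jacobi : JacobiIdentity M₁.Y M₂.Y M₃.Y I
  L_neg_one_derivative : ∀ (n : ℂ) (w₁ : W₁) (w₂ : W₂),
    I n (M₁.L (-1) w₁) w₂ = -n • I (n - 1) w₁ w₂

lemma support_finite_of_truncated {M : Type*} [AddCommGroup M] [Module ℂ M] (c : ℕ → ℂ) (f : ℕ → M)
    (h : ∃ K : ℕ, ∀ i ≥ K, f i = 0) : (Function.support fun i => c i • f i).Finite := by
  obtain ⟨K, hK⟩ := h
  refine (Set.finite_lt_nat K).subset fun i hi => ?_
  by_contra hlt
  exact hi (by simp [hK i (not_lt.mp hlt)])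

lemma IsIntertwiningOperator.add {M₁ : GradedAction 𝒱 W₁} {M₂ : GradedAction 𝒱 W₂}
    {M₃ : GradedAction 𝒱 W₃} {I J : ℂ → W₁ →ₗ[ℂ] W₂ →ₗ[ℂ] W₃}
    (hI : IsIntertwiningOperator M₁ M₂ M₃ I) (hJ : IsIntertwiningOperator M₁ M₂ M₃ J) :
    IsIntertwiningOperator M₁ M₂ M₃ (I + J) := by
  refine ⟨fun w₁ w₂ => ?_, fun v w₁ w₂ l m n => ?_, fun n w₁ w₂ => ?_⟩
  · obtain ⟨N, hN⟩ := hI.truncation w₁ w₂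
    obtain ⟨N', hN'⟩ := hJ.truncation w₁ w₂
    refine ⟨max N N', fun n hn => ?_⟩
    simp [hN n (le_trans (le_max_left _ _) hn), hN' n (le_trans (le_max_right _ _) hn)]
  · have a1 : ∀ {I : ℂ → W₁ →ₗ[ℂ] W₂ →ₗ[ℂ] W₃}, IsIntertwiningOperator M₁ M₂ M₃ I →
        ∃ K : ℕ, ∀ i ≥ K, M₃.Y (m + l - (i : ℤ)) v (I (n + (i : ℂ)) w₁ w₂) = 0 := by
      intro I hI
      obtain ⟨N, hN⟩ := hI.truncation w₁ w₂
      refine ⟨⌈N - n.re⌉₊, fun i hi => ?_⟩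
      rw [hN, map_zero]
      have := Nat.ceil_le.mp hi
      simp only [Complex.add_re, Complex.natCast_re]
      linarith
    have a2 : ∀ {I : ℂ → W₁ →ₗ[ℂ] W₂ →ₗ[ℂ] W₃}, IsIntertwiningOperator M₁ M₂ M₃ I →
        ∃ K : ℕ, ∀ i ≥ K, I (n + (l : ℂ) - (i : ℂ)) w₁ (M₂.Y (m + (i : ℤ)) v w₂) = 0 := by
      intro I _
      obtain ⟨N, hN⟩ := M₂.truncation v w₂
      exact ⟨(N - m).toNat, fun i hi => by rw [hN _ (by omega), map_zero]⟩
    have a3 : ∀ {I : ℂ → W₁ →ₗ[ℂ] W₂ →ₗ[ℂ] W₃}, IsIntertwiningOperator M₁ M₂ M₃ I →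
        ∃ K : ℕ, ∀ i ≥ K, I ((m : ℂ) + n - (i : ℂ)) (M₁.Y (l + (i : ℤ)) v w₁) w₂ = 0 := by
      intro I _
      obtain ⟨N, hN⟩ := M₁.truncation v w₁
      exact ⟨(N - l).toNat, fun i hi => by rw [hN _ (by omega), map_zero, LinearMap.zero_apply]⟩
    have hIj := hI.jacobi v w₁ w₂ l m n
    have hJj := hJ.jacobi v w₁ w₂ l m n
    simp only [Pi.add_apply, LinearMap.add_apply, map_add, smul_add]
    rw [finsum_add_distrib (support_finite_of_truncated _ _ (a1 hI))
        (support_finite_of_truncated _ _ (a1 hJ)),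
      finsum_add_distrib (support_finite_of_truncated _ _ (a2 hI))
        (support_finite_of_truncated _ _ (a2 hJ)),
      finsum_add_distrib (support_finite_of_truncated _ _ (a3 hI))
        (support_finite_of_truncated _ _ (a3 hJ)), ← hIj, ← hJj]
    abel
  · simp [hI.L_neg_one_derivative, hJ.L_neg_one_derivative]

lemma IsIntertwiningOperator.smul {M₁ : GradedAction 𝒱 W₁} {M₂ : GradedAction 𝒱 W₂}
    {M₃ : GradedAction 𝒱 W₃} {I : ℂ → W₁ →ₗ[ℂ] W₂ →ₗ[ℂ] W₃} (c : ℂ)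
    (hI : IsIntertwiningOperator M₁ M₂ M₃ I) : IsIntertwiningOperator M₁ M₂ M₃ (c • I) := by
  refine ⟨fun w₁ w₂ => ?_, fun v w₁ w₂ l m n => ?_, fun n w₁ w₂ => ?_⟩
  · obtain ⟨N, hN⟩ := hI.truncation w₁ w₂
    exact ⟨N, fun n hn => by simp [hN n hn]⟩
  · have := congrArg (c • ·) (hI.jacobi v w₁ w₂ l m n)
    simpa only [Pi.smul_apply, LinearMap.smul_apply, map_smul, smul_sub, smul_finsum,
      smul_comm c] using this
  · simp only [Pi.smul_apply, LinearMap.smul_apply, hI.L_neg_one_derivative, smul_comm c]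

/-- The vector space of intertwining operators of type `(W₃; W₁ W₂)`. -/
def intertwiningOperators (M₁ : GradedAction 𝒱 W₁) (M₂ : GradedAction 𝒱 W₂)
    (M₃ : GradedAction 𝒱 W₃) : Submodule ℂ (ℂ → W₁ →ₗ[ℂ] W₂ →ₗ[ℂ] W₃) where
  carrier := {I | IsIntertwiningOperator M₁ M₂ M₃ I}
  add_mem' hI hJ := hI.add hJ
  zero_mem' := ⟨fun _ _ => ⟨0, fun _ _ => by simp⟩, fun _ _ _ _ _ _ => by simp,
    fun _ _ _ => by simp⟩
  smul_mem' c _ hI := hI.smul c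

/-- The fusion rule: the (cardinal) dimension of the space of intertwining operators. -/
def fusionRule (M₁ : GradedAction 𝒱 W₁) (M₂ : GradedAction 𝒱 W₂) (M₃ : GradedAction 𝒱 W₃) :
    Cardinal :=
  Module.rank ℂ (intertwiningOperators M₁ M₂ M₃)

end Intertwining

/-! ### Weights of the coefficients -/

section Weights

lemma mem_of_eigen {ι W : Type*} [DecidableEq ι] [AddCommGroup W] [Module ℂ W]
    {gr : ι → Submodule ℂ W} (hgr : DirectSum.IsInternal gr) (e : ι → ℂ)
    (he : Function.Injective e) (L : W →ₗ[ℂ] W) (hL : ∀ i, ∀ w ∈ gr i, L w = e i • w)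
    {i : ι} {w : W} (hw : L w = e i • w) : w ∈ gr i := by
  obtain ⟨x, rfl⟩ := hgr.2 w
  have key : ∀ y : DirectSum ι fun i => gr i,
      L (DirectSum.coeAddMonoidHom gr y) =
        DirectSum.coeAddMonoidHom gr (DirectSum.lmap (fun j => e j • (LinearMap.id : gr j →ₗ[ℂ] gr j)) y) := by
    intro y
    induction y using DirectSum.induction_on with
    | zero => simp
    | of j y =>
      have := DirectSum.lmap_lof (R := ℂ) (fun j => e j • (LinearMap.id : gr j →ₗ[ℂ] gr j)) j y
      rw [DirectSum.lof_eq_of] at this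
      rw [this, DirectSum.lof_eq_of, DirectSum.coeAddMonoidHom_of, DirectSum.coeAddMonoidHom_of,
        hL j _ y.2]
      simp
    | add y z hy hz => simp only [map_add, hy, hz]
  rw [key] at hw
  have hsm : ∀ (c : ℂ) (y : DirectSum ι fun i => gr i),
      c • DirectSum.coeAddMonoidHom gr y = DirectSum.coeAddMonoidHom gr (c • y) := fun c y =>
    ((DirectSum.coeLinearMap gr).map_smul c y).symm
  rw [hsm] at hw
  have h2 := hgr.1 hw
  have h3 : ∀ j, j ≠ i → x j = 0 := by
    intro j hj
    have h4 := congrArg (fun z => z j) h2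
    simp only [DirectSum.lmap_apply, LinearMap.smul_apply, LinearMap.id_apply,
      DirectSum.smul_apply] at h4
    have h5 : (e j - e i) • x j = 0 := by rw [sub_smul, h4, sub_self]
    exact (smul_eq_zero.mp h5).resolve_left (sub_ne_zero.mpr fun h => hj (he h))
  have h6 : x = DirectSum.of (fun i => gr i) i (x i) := by
    apply DFinsupp.ext
    intro j
    by_cases hj : j = i
    · subst hj; exact (DirectSum.of_eq_same (β := fun i => gr i) j (x j)).symm
    · rw [h3 j hj]; exact (DirectSum.of_eq_of_ne (β := fun i => gr i) i j (x i) hj).symm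
  rw [h6, DirectSum.coeAddMonoidHom_of]
  exact (x i).2

lemma finsum_eq_zero_add_one {M : Type*} [AddCommMonoid M] (f : ℕ → M) (h : ∀ i ≥ 2, f i = 0) :
    ∑ᶠ i, f i = f 0 + f 1 := by
  rw [finsum_eq_sum_of_support_subset (s := Finset.range 2) f, Finset.sum_range_succ,
    Finset.sum_range_one]
  intro i hi
  by_contra hlt
  exact hi (h i (by simpa [Nat.succ_le_iff] using hlt))

lemma finsum_eq_zero_only {M : Type*} [AddCommMonoid M] (f : ℕ → M) (h : ∀ i ≥ 1, f i = 0) :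
    ∑ᶠ i, f i = f 0 := by
  rw [finsum_eq_zero_add_one f fun i hi => h i (by omega), h 1 le_rfl, add_zero]

variable {W₁ W₂ W₃ : Type*} [AddCommGroup W₁] [Module ℂ W₁] [AddCommGroup W₂] [Module ℂ W₂]
  [AddCommGroup W₃] [Module ℂ W₃]

/-- Bracket with `L(0)`, extracted from the Jacobi identity. -/
lemma JacobiIdentity.bracket_one {κ : Type*} [AddCommGroupWithOne κ]
    {Y₁ : ℤ → V →ₗ[ℂ] W₁ →ₗ[ℂ] W₁} {Y₂ : ℤ → V →ₗ[ℂ] W₂ →ₗ[ℂ] W₂}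
    {Y₃ : ℤ → V →ₗ[ℂ] W₃ →ₗ[ℂ] W₃} {I : κ → W₁ →ₗ[ℂ] W₂ →ₗ[ℂ] W₃}
    (hJ : JacobiIdentity Y₁ Y₂ Y₃ I) (v : V) (w₁ : W₁) (w₂ : W₂) (n : κ) :
    Y₃ 1 v (I n w₁ w₂) = I n w₁ (Y₂ 1 v w₂) + I n (Y₁ 1 v w₁) w₂ + I (n + 1) (Y₁ 0 v w₁) w₂ := by
  have h := hJ v w₁ w₂ 0 1 n
  have hch : ∀ i ≥ 1, Ring.choose (0 : ℤ) i = 0 := fun i hi =>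
    Ring.choose_zero_pos ℤ (by omega)
  have hch' : ∀ i ≥ 2, Ring.choose (1 : ℤ) i = 0 := fun i hi => by
    have := Ring.choose_natCast (R := ℤ) 1 i
    rw [Nat.cast_one] at this
    rw [this, Nat.choose_eq_zero_of_lt (by omega), Nat.cast_zero]
  rw [finsum_eq_zero_only _ fun i hi => by simp [hch i hi],
    finsum_eq_zero_only _ fun i hi => by simp [hch i hi],
    finsum_eq_zero_add_one _ fun i hi => by simp [hch' i hi]] at h
  simp only [Ring.choose_zero_right, Ring.choose_one_right, pow_zero, zpow_zero, mul_one,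
    Int.cast_one, one_smul, Nat.cast_zero, Nat.cast_one, Int.cast_zero, add_zero, sub_zero,
    zero_add] at h
  rw [sub_eq_iff_eq_add.mp h, show (1 : κ) + n = n + 1 from add_comm _ _, add_sub_cancel_right]
  abel

/-- The vector `vₙ w` has weight `wt v + wt w - n - 1`. -/
lemma VertexOperatorAlgebra.Y_mem (𝒱 : VertexOperatorAlgebra V) {h j : ℤ} (n : ℤ) {u v : V}
    (hu : u ∈ 𝒱.gr h) (hv : v ∈ 𝒱.gr j) : 𝒱.Y n u v ∈ 𝒱.gr (h + j - n - 1) := by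
  refine mem_of_eigen 𝒱.internal (fun i : ℤ => (i : ℂ)) Int.cast_injective (𝒱.Y 1 𝒱.ω)
    𝒱.L_zero ?_
  rw [𝒱.jacobi.bracket_one, 𝒱.L_zero _ _ hu, 𝒱.L_zero _ _ hv, 𝒱.L_neg_one_derivative,
    add_sub_cancel_right]
  simp only [map_smul, LinearMap.smul_apply, ← add_smul]
  congr 1
  push_cast
  ring

lemma VertexOperatorAlgebra.L_one_mem (𝒱 : VertexOperatorAlgebra V) {h : ℤ} {v : V}
    (hv : v ∈ 𝒱.gr h) : 𝒱.L 1 v ∈ 𝒱.gr (h - 1) := by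
  have := 𝒱.Y_mem (1 + 1) 𝒱.ω_mem hv
  rwa [show (2 : ℤ) + h - (1 + 1) - 1 = h - 1 by ring] at this

variable {W : Type*} [AddCommGroup W] [Module ℂ W]

lemma GradedAction.IsModule.Y_mem {M : GradedAction 𝒱 W} (hM : M.IsModule) {h : ℤ} {j : ℂ} (n : ℤ)
    {v : V} {w : W} (hv : v ∈ 𝒱.gr h) (hw : w ∈ M.gr j) :
    M.Y n v w ∈ M.gr (h + j - n - 1) := by
  refine mem_of_eigen hM.internal (fun i : ℂ => i) Function.injective_id (M.Y 1 𝒱.ω)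
    (fun n w hw => by simpa [GradedAction.L] using hM.L_zero n w hw) ?_
  have h0 : M.Y 1 𝒱.ω w = j • w := by simpa [GradedAction.L] using hM.L_zero j w hw
  have h1 := hM.L_neg_one_derivative (n + 1) v w
  simp only [VertexOperatorAlgebra.L, show (-1 : ℤ) + 1 = 0 from rfl, add_sub_cancel_right] at h1
  rw [hM.jacobi.bracket_one, 𝒱.L_zero _ _ hv, h0, h1]
  simp only [map_smul, LinearMap.smul_apply, ← add_smul]
  congr 1
  push_cast
  ring

lemma GradedAction.IsModule.L_one_mem {M : GradedAction 𝒱 W} (hM : M.IsModule) {h : ℂ} {w : W}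
    (hw : w ∈ M.gr h) : M.L 1 w ∈ M.gr (h - 1) := by
  have := hM.Y_mem (1 + 1) 𝒱.ω_mem hw
  rwa [show ((2 : ℤ) : ℂ) + h - ((1 + 1 : ℤ) : ℂ) - 1 = h - 1 by push_cast; ring] at this

/-- The families `I` whose coefficient `(w₁)ₙ w₂` has weight `wt w₁ + wt w₂ - n - 1`. -/
def gradedOperators (gr₁ : ℂ → Submodule ℂ W₁) (gr₂ : ℂ → Submodule ℂ W₂)
    (gr₃ : ℂ → Submodule ℂ W₃) : Submodule ℂ (ℂ → W₁ →ₗ[ℂ] W₂ →ₗ[ℂ] W₃) where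
  carrier := {I | ∀ h j n : ℂ, ∀ w₁ ∈ gr₁ h, ∀ w₂ ∈ gr₂ j, I n w₁ w₂ ∈ gr₃ (h + j - n - 1)}
  add_mem' hI hJ h j n w₁ h₁ w₂ h₂ := add_mem (hI h j n w₁ h₁ w₂ h₂) (hJ h j n w₁ h₁ w₂ h₂)
  zero_mem' _ _ _ _ _ _ _ := zero_mem _
  smul_mem' c _ hI h j n w₁ h₁ w₂ h₂ := Submodule.smul_mem _ c (hI h j n w₁ h₁ w₂ h₂)

/-- Every intertwining operator among modules is graded. -/
lemma intertwiningOperators_le {M₁ : GradedAction 𝒱 W₁} {M₂ : GradedAction 𝒱 W₂}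
    {M₃ : GradedAction 𝒱 W₃} (h₁ : M₁.IsModule) (h₂ : M₂.IsModule) (h₃ : M₃.IsModule) :
    intertwiningOperators M₁ M₂ M₃ ≤ gradedOperators M₁.gr M₂.gr M₃.gr := by
  intro I hI h j n w₁ hw₁ w₂ hw₂
  refine mem_of_eigen h₃.internal (fun i : ℂ => i) Function.injective_id (M₃.Y 1 𝒱.ω)
    (fun n w hw => by simpa [GradedAction.L] using h₃.L_zero n w hw) ?_
  have e1 : M₁.Y 1 𝒱.ω w₁ = h • w₁ := by simpa [GradedAction.L] using h₁.L_zero h w₁ hw₁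
  have e2 : M₂.Y 1 𝒱.ω w₂ = j • w₂ := by simpa [GradedAction.L] using h₂.L_zero j w₂ hw₂
  have e3 := hI.L_neg_one_derivative (n + 1) w₁ w₂
  simp only [GradedAction.L, show (-1 : ℤ) + 1 = 0 from rfl, add_sub_cancel_right] at e3
  rw [hI.jacobi.bracket_one, e1, e2, e3]
  simp only [map_smul, LinearMap.smul_apply, ← add_smul]
  congr 1
  ring

end Weights

/-! ### Restricted duals -/

section Dual

variable {W : Type*} [AddCommGroup W] [Module ℂ W]

/-- The restricted dual `W' = ∐ₙ W₍ₙ₎*` of a graded space `W = ∐ₙ W₍ₙ₎`, as the space of the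
functionals on `W` vanishing on all but finitely many weight spaces. -/
def restrictedDual (gr : ℂ → Submodule ℂ W) : Submodule ℂ (Dual ℂ W) where
  carrier := {f | {n : ℂ | ∃ w ∈ gr n, f w ≠ 0}.Finite}
  add_mem' {f g} hf hg := by
    refine (Set.Finite.union hf hg).subset ?_
    rintro n ⟨w, hw, hne⟩
    by_cases h : f w = 0
    · exact Or.inr ⟨w, hw, fun h' => hne (by simp [h, h'])⟩
    · exact Or.inl ⟨w, hw, h⟩
  zero_mem' := by simp
  smul_mem' c f hf := by
    refine Set.Finite.subset hf ?_
    rintro n ⟨w, hw, hne⟩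
    exact ⟨w, hw, fun h => hne (by simp [h])⟩

/-- The grading of the restricted dual: `W'₍ₙ₎ = W₍ₙ₎*`, the functionals vanishing on
all the `W₍ₘ₎`, `m ≠ n`. -/
def dualGrading (gr : ℂ → Submodule ℂ W) (n : ℂ) : Submodule ℂ (restrictedDual gr) where
  carrier := {f | ∀ m ≠ n, ∀ w ∈ gr m, f.1 w = 0}
  add_mem' hf hg m hm w hw := by simp [hf m hm w hw, hg m hm w hw]
  zero_mem' _ _ _ _ := rfl
  smul_mem' c f hf m hm w hw := by simp [hf m hm w hw]

/-- The linear map given on each weight space `gr h` of `W = ∐ₕ gr h` by `F h`. -/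
def gradedLift {κ N : Type*} [DecidableEq κ] [AddCommGroup N] [Module ℂ N]
    (gr : κ → Submodule ℂ W) (hgr : DirectSum.IsInternal gr) (F : ∀ h, gr h →ₗ[ℂ] N) : W →ₗ[ℂ] N :=
  DirectSum.toModule ℂ κ N F ∘ₗ
    (LinearEquiv.ofBijective (DirectSum.coeLinearMap gr) hgr).symm.toLinearMap

lemma gradedLift_apply {κ N : Type*} [DecidableEq κ] [AddCommGroup N] [Module ℂ N]
    (gr : κ → Submodule ℂ W) (hgr : DirectSum.IsInternal gr) (F : ∀ h, gr h →ₗ[ℂ] N) {h : κ}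
    {w : W} (hw : w ∈ gr h) : gradedLift gr hgr F w = F h ⟨w, hw⟩ := by
  have : (LinearEquiv.ofBijective (DirectSum.coeLinearMap gr) hgr).symm w =
      DirectSum.lof ℂ κ (fun i => gr i) h ⟨w, hw⟩ := by
    rw [LinearEquiv.symm_apply_eq]
    exact (DirectSum.coeLinearMap_of gr h ⟨w, hw⟩).symm
  rw [gradedLift, LinearMap.comp_apply, LinearEquiv.coe_coe, this, DirectSum.toModule_lof]

lemma graded_induction {κ : Type*} [DecidableEq κ] {gr : κ → Submodule ℂ W}
    (hgr : DirectSum.IsInternal gr) {p : W → Prop} (w : W) (hom : ∀ h, ∀ w ∈ gr h, p w)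
    (zero : p 0) (add : ∀ x y, p x → p y → p (x + y)) : p w := by
  have : w ∈ iSup gr := by rw [hgr.submodule_iSup_eq_top]; trivial
  exact Submodule.iSup_induction gr (motive := p) this hom zero add

lemma eval_mem {gr : ℂ → Submodule ℂ W} (hgr : DirectSum.IsInternal gr) (w : W) :
    (LinearMap.applyₗ w ∘ₗ (restrictedDual gr).subtype) ∈ restrictedDual (dualGrading gr) := by
  induction w using graded_induction hgr with
  | hom h w hw =>
    refine (Set.finite_singleton h).subset ?_
    rintro n ⟨f, hf, hne⟩
    by_contra hn
    exact hne (hf h (fun e => hn e.symm) w hw)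
  | zero => rw [map_zero, LinearMap.zero_comp]; exact zero_mem _
  | add x y hx hy => rw [map_add, LinearMap.add_comp]; exact add_mem hx hy

/-- The canonical map `W → W''`, `w ↦ (w' ↦ ⟨w', w⟩)`. -/
def evalMap (gr : ℂ → Submodule ℂ W) (hgr : DirectSum.IsInternal gr) :
    W →ₗ[ℂ] restrictedDual (dualGrading gr) where
  toFun w := ⟨LinearMap.applyₗ w ∘ₗ (restrictedDual gr).subtype, eval_mem hgr w⟩
  map_add' x y := by ext; simp
  map_smul' c x := by ext; simp

/-- Extension by zero of a functional on `W₍ₙ₎`. -/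
def extendDual (gr : ℂ → Submodule ℂ W) (hgr : DirectSum.IsInternal gr) (n : ℂ) :
    Dual ℂ (gr n) →ₗ[ℂ] Dual ℂ W where
  toFun g := gradedLift gr hgr fun h => if e : h = n then e ▸ g else 0
  map_add' f g := by
    ext w
    induction w using graded_induction hgr with
    | hom h w hw =>
      simp only [LinearMap.add_apply, gradedLift_apply gr hgr _ hw]
      split_ifs with e
      · subst e; rfl
      · simp
    | zero => simp
    | add x y hx hy => simp only [map_add, hx, hy]
  map_smul' c f := by
    ext w
    induction w using graded_induction hgr with
    | hom h w hw =>
      simp only [LinearMap.smul_apply, gradedLift_apply gr hgr _ hw, RingHom.id_apply]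
      split_ifs with e
      · subst e; rfl
      · simp
    | zero => simp
    | add x y hx hy => simp only [map_add, hx, hy]

lemma extendDual_same (gr : ℂ → Submodule ℂ W) (hgr : DirectSum.IsInternal gr) (n : ℂ)
    (g : Dual ℂ (gr n)) {w : W} (hw : w ∈ gr n) : extendDual gr hgr n g w = g ⟨w, hw⟩ := by
  show gradedLift gr hgr _ w = _
  rw [gradedLift_apply gr hgr _ hw, dif_pos rfl]

lemma extendDual_ne (gr : ℂ → Submodule ℂ W) (hgr : DirectSum.IsInternal gr) (n : ℂ)
    (g : Dual ℂ (gr n)) {m : ℂ} (hm : m ≠ n) {w : W} (hw : w ∈ gr m) :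
    extendDual gr hgr n g w = 0 := by
  show gradedLift gr hgr _ w = _
  rw [gradedLift_apply gr hgr _ hw, dif_neg hm, LinearMap.zero_apply]

lemma extendDual_mem (gr : ℂ → Submodule ℂ W) (hgr : DirectSum.IsInternal gr) (n : ℂ)
    (g : Dual ℂ (gr n)) : extendDual gr hgr n g ∈ restrictedDual gr := by
  refine (Set.finite_singleton n).subset ?_
  rintro m ⟨w, hw, hne⟩
  by_contra hm
  exact hne (extendDual_ne gr hgr n g hm hw)

lemma evalMap_injective (gr : ℂ → Submodule ℂ W) (hgr : DirectSum.IsInternal gr) :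
    Function.Injective (evalMap gr hgr) := by
  rw [injective_iff_map_eq_zero]
  intro w hw
  obtain ⟨x, rfl⟩ := hgr.2 w
  have key : ∀ (n : ℂ) (g : Dual ℂ (gr n)) (y : DirectSum ℂ fun i => gr i),
      extendDual gr hgr n g (DirectSum.coeAddMonoidHom gr y) = g (y n) := by
    intro n g y
    induction y using DirectSum.induction_on with
    | zero => simp
    | of j y =>
      rw [DirectSum.coeAddMonoidHom_of]
      by_cases hj : j = n
      · subst hj
        rw [extendDual_same gr hgr _ g y.2, DirectSum.of_eq_same]
      · rw [extendDual_ne gr hgr n g hj y.2, DirectSum.of_eq_of_ne _ _ _ (Ne.symm hj), map_zero]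
    | add y z hy hz => simp only [map_add, hy, hz, DirectSum.add_apply]
  have hx : x = 0 := by
    apply DFinsupp.ext
    intro n
    refine (Module.forall_dual_apply_eq_zero_iff ℂ (x n)).mp fun g => ?_
    rw [← key n g x]
    exact congrArg (fun φ => φ.1 ⟨_, extendDual_mem gr hgr n g⟩) hw
  rw [hx, map_zero]

lemma restrictedDual_le_span (gr : ℂ → Submodule ℂ W) (hgr : DirectSum.IsInternal gr)
    (f : restrictedDual gr) : f ∈ ⨆ n, dualGrading gr n := by
  have hfin : {n : ℂ | ∃ w ∈ gr n, f.1 w ≠ 0}.Finite := f.2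
  have hsum : f = ∑ n ∈ hfin.toFinset, (⟨extendDual gr hgr n (f.1 ∘ₗ (gr n).subtype),
      extendDual_mem gr hgr n _⟩ : restrictedDual gr) := by
    apply Subtype.ext
    rw [Submodule.coe_sum]
    ext w
    rw [LinearMap.sum_apply]
    induction w using graded_induction hgr with
    | hom h w hw =>
      by_cases hh : h ∈ hfin.toFinset
      · rw [Finset.sum_eq_single h, extendDual_same gr hgr h _ hw]
        · rfl
        · exact fun n _ hn => extendDual_ne gr hgr n _ hn.symm hw
        · exact fun h' => absurd hh h'
      · rw [Finset.sum_eq_zero fun n hn => extendDual_ne gr hgr n _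
          (fun e : h = n => hh (by rw [e]; exact hn)) hw]
        by_contra hne
        exact hh (by simpa using ⟨w, hw, hne⟩)
    | zero => simp
    | add x y hx hy => simp only [map_add, hx, hy, Finset.sum_add_distrib]
  rw [hsum]
  refine Submodule.sum_mem _ fun n _ => Submodule.mem_iSup_of_mem n ?_
  exact fun m hm w hw => extendDual_ne gr hgr n _ hm hw

lemma evalMap_surjective (gr : ℂ → Submodule ℂ W) (hgr : DirectSum.IsInternal gr)
    (hfin : ∀ n, FiniteDimensional ℂ (gr n)) : Function.Surjective (evalMap gr hgr) := by
  intro φ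
  have hφ : {n : ℂ | ∃ f ∈ dualGrading gr n, φ.1 f ≠ 0}.Finite := φ.2
  -- the component of weight `n`
  have hcomp : ∀ n : ℂ, ∃ w : gr n, ∀ g : Dual ℂ (gr n),
      φ.1 ⟨extendDual gr hgr n g, extendDual_mem gr hgr n g⟩ = g w := by
    intro n
    have := hfin n
    let ψ : Dual ℂ (Dual ℂ (gr n)) :=
      φ.1 ∘ₗ (extendDual gr hgr n).codRestrict _ (extendDual_mem gr hgr n)
    refine ⟨(Module.evalEquiv ℂ (gr n)).symm ψ, fun g => ?_⟩
    rw [Module.apply_evalEquiv_symm_apply]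
    rfl
  choose c hc using hcomp
  refine ⟨∑ n ∈ hφ.toFinset, (c n : W), ?_⟩
  apply Subtype.ext
  ext f
  have hf := restrictedDual_le_span gr hgr f
  induction hf using Submodule.iSup_induction' with
  | zero => simp
  | add x y _ _ hx hy => rw [map_add, map_add, hx, hy]
  | mem n f hf =>
    have hfe : f = ⟨extendDual gr hgr n (f.1 ∘ₗ (gr n).subtype), extendDual_mem gr hgr n _⟩ := by
      apply Subtype.ext
      ext w
      induction w using graded_induction hgr with
      | hom h w hw =>
        by_cases hh : h = n
        · subst hh; rw [extendDual_same gr hgr _ _ hw]; rfl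
        · rw [extendDual_ne gr hgr n _ hh hw, hf h hh w hw]
      | zero => simp
      | add x y hx hy => simp only [map_add, hx, hy]
    have h1 : φ.1 f = f.1 (c n) := by
      conv_lhs => rw [hfe]
      rw [hc]
      rfl
    have h2 : (evalMap gr hgr (∑ n ∈ hφ.toFinset, (c n : W))).1 f =
        ∑ m ∈ hφ.toFinset, f.1 (c m : W) := by
      show f.1 (∑ n ∈ hφ.toFinset, (c n : W)) = _
      rw [map_sum]
    rw [h1, h2]
    by_cases hn : n ∈ hφ.toFinset
    · rw [Finset.sum_eq_single n]
      · exact fun m _ hm => hf m hm _ (c m).2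
      · exact fun h => absurd hn h
    · rw [Finset.sum_eq_zero fun m hm => hf m (fun e => hn (e ▸ hm)) _ (c m).2, ← h1]
      by_contra hne
      exact hn (by simpa using ⟨f.1, f.2, hf, fun e => hne e.symm⟩)

/-- The canonical identification `W ≃ W''` of a graded space with finite-dimensional weight spaces
with its double restricted dual. -/
def bidualEquiv (gr : ℂ → Submodule ℂ W) (hgr : DirectSum.IsInternal gr)
    (hfin : ∀ n, FiniteDimensional ℂ (gr n)) :
    W ≃ₗ[ℂ] restrictedDual (dualGrading gr) :=
  LinearEquiv.ofBijective (evalMap gr hgr)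
    ⟨evalMap_injective gr hgr, evalMap_surjective gr hgr hfin⟩

end Dual

/-! ### Contragredients -/

section Contragredient

variable {W₁ W₂ W₃ : Type*} [AddCommGroup W₁] [Module ℂ W₁] [AddCommGroup W₂] [Module ℂ W₂]
  [AddCommGroup W₃] [Module ℂ W₃]

/-- The coefficient of `x^(-m-1)` in `I(e^{x L(1)} c(L(0)) x^(-2 L(0)) w₁, x⁻¹) w₂`, where `c(L(0))`
acts as the scalar `c h` on the vectors of weight `h`. For `w₁` of weight `h`, the series is
`∑ₖ ∑ₙ (c h / k!) x^(k-2h) (L(1)ᵏ w₁)ₙ w₂ x^(n+1)`, and the terms containing `x^(-m-1)` are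
those with `n = 2h - k - m - 2`. The sum over `k` is finite as `L(1)` lowers weights by one. -/
def oppositeCoeff {κ : Type*} [CommRing κ] [DecidableEq κ] (gr₁ : κ → Submodule ℂ W₁)
    (hgr : DirectSum.IsInternal gr₁) (L₁ : W₁ →ₗ[ℂ] W₁) (c : κ → ℂ)
    (I : κ → W₁ →ₗ[ℂ] W₂ →ₗ[ℂ] W₃) (m : κ) : W₁ →ₗ[ℂ] W₂ →ₗ[ℂ] W₃ :=
  gradedLift gr₁ hgr fun h => ∑ᶠ k : ℕ, (c h / (k.factorial : ℂ)) •
    (I (2 * h - (k : κ) - m - 2) ∘ₗ (L₁ ^ k) ∘ₗ (gr₁ h).subtype)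

lemma pow_mem_gr {κ : Type*} [CommRing κ] {gr₁ : κ → Submodule ℂ W₁} {L₁ : W₁ →ₗ[ℂ] W₁}
    (hL : ∀ h, ∀ w ∈ gr₁ h, L₁ w ∈ gr₁ (h - 1)) {h : κ} {w : W₁} (hw : w ∈ gr₁ h) (k : ℕ) :
    (L₁ ^ k) w ∈ gr₁ (h - (k : κ)) := by
  induction k with
  | zero => simpa using hw
  | succ k ih =>
    rw [pow_succ', Module.End.mul_apply, Nat.cast_succ, ← sub_sub]
    exact hL _ _ ih

lemma oppositeCoeff_apply {κ : Type*} [CommRing κ] [DecidableEq κ] {gr₁ : κ → Submodule ℂ W₁}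
    (hgr : DirectSum.IsInternal gr₁) (L₁ : W₁ →ₗ[ℂ] W₁) (c : κ → ℂ)
    (I : κ → W₁ →ₗ[ℂ] W₂ →ₗ[ℂ] W₃) (m : κ) (hL : ∀ h, ∀ w ∈ gr₁ h, L₁ w ∈ gr₁ (h - 1))
    {h : κ} (hbot : ∃ K : ℕ, ∀ k ≥ K, gr₁ (h - (k : κ)) = ⊥) {w₁ : W₁} (hw : w₁ ∈ gr₁ h)
    (w₂ : W₂) : oppositeCoeff gr₁ hgr L₁ c I m w₁ w₂ =
      ∑ᶠ k : ℕ, (c h / (k.factorial : ℂ)) •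
        I (2 * h - (k : κ) - m - 2) ((L₁ ^ k) w₁) w₂ := by
  obtain ⟨K, hK⟩ := hbot
  have hz : ∀ k ≥ K, ∀ w ∈ gr₁ h, (L₁ ^ k) w = 0 := fun k hk w hw => by
    have := pow_mem_gr hL hw k
    rwa [hK k hk, Submodule.mem_bot] at this
  rw [oppositeCoeff, gradedLift_apply gr₁ hgr _ hw,
    finsum_eq_sum_of_support_subset (s := Finset.range K),
    finsum_eq_sum_of_support_subset (s := Finset.range K)]
  · simp [LinearMap.sum_apply]
  · intro k hk
    by_contra hlt
    refine hk ?_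
    simp only [Finset.coe_range, Set.mem_Iio, not_lt] at hlt
    simp [hz k hlt w₁ hw]
  · intro k hk
    by_contra hlt
    refine hk ?_
    simp only [Finset.coe_range, Set.mem_Iio, not_lt] at hlt
    ext w
    simp [hz k hlt w w.2]

lemma oppositeCoeff_mem {κ : Type*} [CommRing κ] [DecidableEq κ] (φ : κ →+* ℂ)
    {gr₁ : κ → Submodule ℂ W₁} {gr₂ : ℂ → Submodule ℂ W₂} {gr₃ : ℂ → Submodule ℂ W₃}
    (hgr : DirectSum.IsInternal gr₁) (L₁ : W₁ →ₗ[ℂ] W₁) (c : κ → ℂ)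
    (I : κ → W₁ →ₗ[ℂ] W₂ →ₗ[ℂ] W₃) (m : κ) (hL : ∀ h, ∀ w ∈ gr₁ h, L₁ w ∈ gr₁ (h - 1))
    (hI : ∀ h j n, ∀ w₁ ∈ gr₁ h, ∀ w₂ ∈ gr₂ j, I n w₁ w₂ ∈ gr₃ (φ h + j - φ n - 1))
    {h : κ} {j : ℂ} {w₁ : W₁} {w₂ : W₂} (h₁ : w₁ ∈ gr₁ h) (h₂ : w₂ ∈ gr₂ j) :
    oppositeCoeff gr₁ hgr L₁ c I m w₁ w₂ ∈ gr₃ (j - φ h + φ m + 1) := by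
  rw [oppositeCoeff, gradedLift_apply gr₁ hgr _ h₁]
  refine finsum_induction (fun T : gr₁ h →ₗ[ℂ] W₂ →ₗ[ℂ] W₃ =>
    T ⟨w₁, h₁⟩ w₂ ∈ gr₃ (j - φ h + φ m + 1)) (by simp) (fun S T hS hT => ?_) fun k => ?_
  · exact add_mem hS hT
  · refine Submodule.smul_mem _ _ ?_
    have := hI (h - (k : κ)) j (2 * h - (k : κ) - m - 2) _ (pow_mem_gr hL h₁ k) w₂ h₂
    simp only [map_sub, map_mul, map_natCast, map_ofNat] at this
    rwa [show φ h - k + j - (2 * φ h - k - φ m - 2) - 1 = j - φ h + φ m + 1 by ring] at this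

lemma comp_mem_restrictedDual {κ : Type*} [CommRing κ] [DecidableEq κ] (φ : κ →+* ℂ)
    {gr₁ : κ → Submodule ℂ W₁} {gr₂ : ℂ → Submodule ℂ W₂} {gr₃ : ℂ → Submodule ℂ W₃}
    (hgr : DirectSum.IsInternal gr₁) (T : W₁ →ₗ[ℂ] W₂ →ₗ[ℂ] W₃) (m : κ)
    (hT : ∀ h j, ∀ w₁ ∈ gr₁ h, ∀ w₂ ∈ gr₂ j, T w₁ w₂ ∈ gr₃ (j - φ h + φ m + 1))
    (w₁ : W₁) (f : Dual ℂ W₃) (hf : f ∈ restrictedDual gr₃) :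
    f ∘ₗ T w₁ ∈ restrictedDual gr₂ := by
  induction w₁ using graded_induction hgr with
  | hom h w hw =>
    have hf' : {n : ℂ | ∃ w ∈ gr₃ n, f w ≠ 0}.Finite := hf
    refine (hf'.preimage (f := fun j : ℂ => j - φ h + φ m + 1) fun a _ b _ hab => ?_).subset ?_
    · simpa using hab
    · rintro j ⟨w₂, hw₂, hne⟩
      exact ⟨_, hT h j w hw w₂ hw₂, hne⟩
  | zero => rw [map_zero, LinearMap.comp_zero]; exact zero_mem _
  | add x y hx hy => rw [map_add, LinearMap.comp_add]; exact add_mem hx hy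

/-- The transpose `⟨dualTranspose T w₁ w₃', w₂⟩ = ⟨w₃', T w₁ w₂⟩` on restricted duals. -/
def dualTranspose {gr₂ : ℂ → Submodule ℂ W₂} {gr₃ : ℂ → Submodule ℂ W₃}
    (T : W₁ →ₗ[ℂ] W₂ →ₗ[ℂ] W₃)
    (hT : ∀ w₁, ∀ f ∈ restrictedDual gr₃, f ∘ₗ T w₁ ∈ restrictedDual gr₂) :
    W₁ →ₗ[ℂ] restrictedDual gr₃ →ₗ[ℂ] restrictedDual gr₂ :=
  LinearMap.mk₂ ℂ (fun w₁ f => ⟨f.1 ∘ₗ T w₁, hT w₁ f.1 f.2⟩)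
    (fun x y f => by ext; simp) (fun c x f => by ext; simp)
    (fun x f g => by ext; simp) (fun c x f => by ext; simp)

variable {W : Type*} [AddCommGroup W] [Module ℂ W]

/-- The coefficient of `x^(-m-1)` in `Y(e^{x L(1)} (-x⁻²)^{L(0)} v, x⁻¹)`. -/
def GradedAction.oppositeY (M : GradedAction 𝒱 W) (m : ℤ) : V →ₗ[ℂ] W →ₗ[ℂ] W :=
  oppositeCoeff 𝒱.gr 𝒱.internal (𝒱.L 1) (fun h : ℤ => (-1 : ℂ) ^ h) M.Y m

lemma GradedAction.IsModule.oppositeY_mem {M : GradedAction 𝒱 W} (hM : M.IsModule) (m : ℤ)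
    (h : ℤ) (j : ℂ) (v : V) (hv : v ∈ 𝒱.gr h) (w : W) (hw : w ∈ M.gr j) :
    M.oppositeY m v w ∈ M.gr (j - Int.castRingHom ℂ h + Int.castRingHom ℂ m + 1) :=
  oppositeCoeff_mem (Int.castRingHom ℂ) 𝒱.internal _ _ M.Y m (fun _ _ hw => 𝒱.L_one_mem hw)
    (fun h j n w₁ h₁ w₂ h₂ => by simpa using hM.Y_mem n h₁ h₂) hv hw

/-- The contragredient `W'` of a module `W`:
`⟨Y'(v,x) w', w⟩ = ⟨w', Y(e^{x L(1)} (-x⁻²)^{L(0)} v, x⁻¹) w⟩`. -/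
def GradedAction.contragredient (M : GradedAction 𝒱 W) (hM : M.IsModule) :
    GradedAction 𝒱 (restrictedDual M.gr) where
  gr := dualGrading M.gr
  Y m := dualTranspose (M.oppositeY m)
    (comp_mem_restrictedDual (Int.castRingHom ℂ) 𝒱.internal _ m (hM.oppositeY_mem m))
  truncation v f := by
    induction v using graded_induction 𝒱.internal with
    | hom h v hv =>
      have hf : {n : ℂ | ∃ w ∈ M.gr n, f.1 w ≠ 0}.Finite := f.2
      obtain ⟨B, hB⟩ := (hf.image Complex.re).bddAbove
      obtain ⟨N₀, hN₀⟩ := hM.lower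
      refine ⟨⌈B - N₀ + h⌉, fun n hn => ?_⟩
      have hn' := Int.ceil_le.mp hn
      apply Subtype.ext
      ext w
      show f.1 (M.oppositeY n v w) = 0
      induction w using graded_induction hM.internal with
      | hom j w hw =>
        by_contra hne
        have h1 := hB ⟨_, ⟨_, hM.oppositeY_mem n h j v hv w hw, hne⟩, rfl⟩
        have h2 : N₀ ≤ j.re := by
          by_contra hlt
          have h3 := hN₀ j (not_le.mp hlt)
          rw [h3, Submodule.mem_bot] at hw
          exact hne (by rw [hw, map_zero, map_zero])
        simp at h1
        linarith
      | zero => simp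
      | add x y hx hy => simp only [map_add, hx, hy, add_zero]
    | zero => exact ⟨0, fun n _ => by simp⟩
    | add x y hx hy =>
      obtain ⟨N, hN⟩ := hx
      obtain ⟨N', hN'⟩ := hy
      refine ⟨max N N', fun n hn => ?_⟩
      rw [map_add, LinearMap.add_apply, hN n (le_trans (le_max_left _ _) hn),
        hN' n (le_trans (le_max_right _ _) hn), add_zero]

/-- The defining formula of the contragredient, in coefficients. -/
lemma GradedAction.contragredient_Y_apply (M : GradedAction 𝒱 W) (hM : M.IsModule) (m : ℤ) {h : ℤ}
    {v : V} (hv : v ∈ 𝒱.gr h) (f : restrictedDual M.gr) (w : W) :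
    ((M.contragredient hM).Y m v f).1 w =
      f.1 (∑ᶠ k : ℕ, ((-1 : ℂ) ^ h / (k.factorial : ℂ)) •
        M.Y (2 * h - (k : ℤ) - m - 2) ((𝒱.L 1 ^ k) v) w) := by
  obtain ⟨N, hN⟩ := 𝒱.lower
  exact congrArg f.1 (oppositeCoeff_apply 𝒱.internal (𝒱.L 1) (fun h : ℤ => (-1 : ℂ) ^ h) M.Y m
    (fun _ _ hw => 𝒱.L_one_mem hw)
    ⟨(h - N + 1).toNat, fun k hk => hN _ (by omega)⟩ hv w)

/-- The coefficient of `x^(-m-1)` in `I(e^{x L(1)} e^{(2r+1) π i L(0)} x^(-2 L(0)) w₁, x⁻¹)`. -/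
def oppositeOperator {M₁ : GradedAction 𝒱 W₁} (h₁ : M₁.IsModule) (r : ℤ)
    (I : ℂ → W₁ →ₗ[ℂ] W₂ →ₗ[ℂ] W₃) (m : ℂ) : W₁ →ₗ[ℂ] W₂ →ₗ[ℂ] W₃ :=
  oppositeCoeff M₁.gr h₁.internal (M₁.L 1)
    (fun h : ℂ => Complex.exp ((2 * r + 1) * Real.pi * Complex.I * h)) I m

lemma oppositeOperator_mem {M₁ : GradedAction 𝒱 W₁} (h₁ : M₁.IsModule) (r : ℤ)
    {gr₂ : ℂ → Submodule ℂ W₂} {gr₃ : ℂ → Submodule ℂ W₃}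
    (I : gradedOperators M₁.gr gr₂ gr₃) (m h j : ℂ) (w₁ : W₁) (hw₁ : w₁ ∈ M₁.gr h) (w₂ : W₂)
    (hw₂ : w₂ ∈ gr₂ j) :
    oppositeOperator h₁ r I.1 m w₁ w₂ ∈ gr₃ (j - RingHom.id ℂ h + RingHom.id ℂ m + 1) :=
  oppositeCoeff_mem (RingHom.id ℂ) h₁.internal _ _ I.1 m (fun _ _ hw => h₁.L_one_mem hw)
    (fun h j n w₁ h₁ w₂ h₂ => I.2 h j n w₁ h₁ w₂ h₂) hw₁ hw₂

/-- The `r`-contragredient operator `A_r(I)`: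
`⟨A_r(I)(w₁,x) w₃', w₂⟩ = ⟨w₃', I(e^{x L(1)} e^{(2r+1) π i L(0)} x^(-2 L(0)) w₁, x⁻¹) w₂⟩`. -/
def contragredientOperator {M₁ : GradedAction 𝒱 W₁} (h₁ : M₁.IsModule) (r : ℤ)
    {gr₂ : ℂ → Submodule ℂ W₂} {gr₃ : ℂ → Submodule ℂ W₃}
    (I : gradedOperators M₁.gr gr₂ gr₃) :
    gradedOperators M₁.gr (dualGrading gr₃) (dualGrading gr₂) :=
  ⟨fun m => dualTranspose (oppositeOperator h₁ r I.1 m)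
    (comp_mem_restrictedDual (RingHom.id ℂ) h₁.internal _ m (oppositeOperator_mem h₁ r I m)), by
    intro h j n w₁ hw₁ f hf p hp w₂ hw₂
    refine hf _ (fun e => hp ?_) _ (oppositeOperator_mem h₁ r I n h p w₁ hw₁ w₂ hw₂)
    simp only [RingHom.id_apply] at e
    rw [← e]
    ring⟩

/-- The defining formula of the `r`-contragredient operator, in coefficients. -/
lemma contragredientOperator_apply {M₁ : GradedAction 𝒱 W₁} (h₁ : M₁.IsModule) (r : ℤ)
    {gr₂ : ℂ → Submodule ℂ W₂} {gr₃ : ℂ → Submodule ℂ W₃}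
    (I : gradedOperators M₁.gr gr₂ gr₃) (m : ℂ) {h : ℂ} {w₁ : W₁} (hw₁ : w₁ ∈ M₁.gr h)
    (f : restrictedDual gr₃) (w₂ : W₂) :
    ((contragredientOperator h₁ r I).1 m w₁ f).1 w₂ =
      f.1 (∑ᶠ k : ℕ,
        (Complex.exp ((2 * r + 1) * Real.pi * Complex.I * h) / (k.factorial : ℂ)) •
          I.1 (2 * h - (k : ℂ) - m - 2) ((M₁.L 1 ^ k) w₁) w₂) := by
  obtain ⟨N, hN⟩ := h₁.lower
  refine congrArg f.1 (oppositeCoeff_apply h₁.internal (M₁.L 1)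
    (fun h : ℂ => Complex.exp ((2 * r + 1) * Real.pi * Complex.I * h)) I.1 m
    (fun _ _ hw => h₁.L_one_mem hw) ⟨⌊h.re - N⌋₊ + 1, fun k hk => hN _ ?_⟩ hw₁ w₂)
  have := (Nat.floor_lt' (n := k) (by omega)).mp (Nat.lt_of_succ_le hk)
  simp only [Complex.sub_re, Complex.natCast_re]
  linarith

/-- An intertwining operator among modules, as a graded operator. -/
def toGraded {M₁ : GradedAction 𝒱 W₁} {M₂ : GradedAction 𝒱 W₂} {M₃ : GradedAction 𝒱 W₃}
    (h₁ : M₁.IsModule) (h₂ : M₂.IsModule) (h₃ : M₃.IsModule)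
    (I : intertwiningOperators M₁ M₂ M₃) : gradedOperators M₁.gr M₂.gr M₃.gr :=
  ⟨I.1, intertwiningOperators_le h₁ h₂ h₃ I.2⟩

end Contragredient

end VOA

end

/-! Replacing x by x^{-1} and dressing the vectors by e^{xL(1)} c(L(0)) x^{-2L(0)} turns the Jacobi
identity into one with the two products in the opposite order; transposing to restricted duals
restores the order. So everything reduces to an identity for the undualized opposite coefficients,
`JacobiIdentity.opposite`.

In that identity the product terms match the original ones after a substitution of indices. The
iterate term needs the conjugation of Y(v,x_0) by e^{xL(1)}. In coefficients this comes from
iterating [L(1), v_n] = (L(1)v)_n + (2h-n-2) v_{n+1} for v of weight h (`IsGradedRep.L_one_pow_Y`),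
and the double sum that results collapses by Vandermonde's identity (`sum_neg_one_pow_mul_choose`).

The only property of c used there is c(h+n) = (-1)^n c(h) for integers n. It holds for (-1)^h and
for e^{(2r+1)πih}, so one argument yields both the contragredient module and A_r. The derivative
property is the sl_2 relation between L(1) and L(-1) (`oppositeCoeff_L_neg_one`).

For the inversion, L(1) lowers weights by one, so moving c(L(0)) past e^{xL(1)} turns it into
e^{-xL(1)}. Applying the construction twice cancels the exponentials and leaves the scalar c'c
(`oppositeCoeff_oppositeCoeff`), which is 1 when r + s = -1. The same computation with (-1)^h shows
that W → W'' respects the action, so A_{-r-1}, transported along this identification, inverts A_r.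
-/

namespace VOA

/-! ### Binomial identities and iterated commutators -/

section Combinatorics

lemma succ_mul_choose_succ (a : ℤ) (s : ℕ) :
    ((s : ℤ) + 1) * Ring.choose a (s + 1) = (a - s) * Ring.choose a s := by
  have h := Ring.choose_smul_choose a (Nat.le_succ s)
  rw [Nat.choose_succ_self_right, Nat.succ_sub (le_refl s), Nat.sub_self, nsmul_eq_mul] at h
  simp only [Nat.succ_eq_add_one, Nat.cast_add, Nat.cast_one, zero_add,
    Ring.choose_one_right] at h
  rw [h, mul_comm]

lemma choose_eq_neg_one_pow_mul (a : ℤ) (s : ℕ) :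
    Ring.choose a s = (-1) ^ s * Ring.choose (s - 1 - a) s := by
  have h := Ring.choose_neg (-a) s
  rw [neg_neg, Units.smul_def, Int.coe_negOnePow_natCast, smul_eq_mul] at h
  rw [h, show -a + (s : ℤ) - 1 = s - 1 - a by ring]

/-- Upper negation turns the second factor into a sign times C(t-1-A, p.2), whose upper entry no
longer depends on p.1. What remains is Vandermonde's convolution. -/
lemma sum_neg_one_pow_mul_choose (A m : ℤ) (t : ℕ) :
    ∑ p ∈ Finset.HasAntidiagonal.antidiagonal t, (-1) ^ p.1 * Ring.choose m p.1 * Ring.choose (A - p.1) p.2 =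
      Ring.choose (A - m) t := by
  rw [choose_eq_neg_one_pow_mul (A - m) t,
    show (t : ℤ) - 1 - (A - m) = m + (t - 1 - A) by ring,
    Ring.add_choose_eq t (Commute.all _ _), Finset.mul_sum]
  refine Finset.sum_congr rfl fun p hp => ?_
  have ht := Finset.HasAntidiagonal.mem_antidiagonal.mp hp
  rw [choose_eq_neg_one_pow_mul (A - p.1) p.2, ← ht, pow_add,
    show (p.2 : ℤ) - 1 - (A - p.1) = ((p.1 + p.2 : ℕ) : ℤ) - 1 - A by push_cast; ring]
  ring

/-- The triangle a + b < P contains the rectangle A × B outside which g vanishes. -/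
lemma sum_range_antidiagonal {M : Type*} [AddCommMonoid M] (g : ℕ → ℕ → M) {A B P : ℕ}
    (hA : ∀ a ≥ A, ∀ b, g a b = 0) (hB : ∀ a, ∀ b ≥ B, g a b = 0) (hP : A + B ≤ P) :
    ∑ p ∈ Finset.range P, ∑ q ∈ Finset.HasAntidiagonal.antidiagonal p, g q.1 q.2 =
      ∑ a ∈ Finset.range A, ∑ b ∈ Finset.range B, g a b := by
  simp only [Finset.Nat.sum_antidiagonal_eq_sum_range_succ g, Nat.succ_eq_add_one]
  rw [Finset.sum_range_diag_flip]
  rw [← Finset.sum_subset (Finset.range_mono (show A ≤ P by omega))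
    fun a _ ha => Finset.sum_eq_zero fun b _ => hA a (by simpa using ha) b]
  refine Finset.sum_congr rfl fun a ha => ?_
  have := Finset.mem_range.mp ha
  exact (Finset.sum_subset (Finset.range_mono (by omega))
    fun b _ hb => hB a b (by simpa using hb)).symm

/-- Truncating at an arbitrary large N lets several sums share one finite range without tracking
individual bounds. -/
lemma finsum_eventually_eq {M : Type*} [AddCommMonoid M] (f : ℕ → M)
    (h : ∃ K : ℕ, ∀ i ≥ K, f i = 0) :
    ∀ᶠ N in Filter.atTop, ∑ᶠ i, f i = ∑ i ∈ Finset.range N, f i := by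
  obtain ⟨K, hK⟩ := h
  filter_upwards [Filter.eventually_ge_atTop K] with N hN
  refine finsum_eq_sum_of_support_subset _ fun i hi => ?_
  by_contra hlt
  exact hi (hK i (by simp at hlt; omega))

/-- Iterates of a map acting on a two-parameter family by raising either of the parameters. -/
lemma iterate_two_parameter {M : Type*} [AddCommGroup M] [Module ℂ M] (D : M →ₗ[ℂ] M)
    (X : ℕ → ℕ → M) (a : ℤ)
    (hD : ∀ k s, D (X k s) = X (k + 1) s + ((a - 2 * k - s : ℤ) : ℂ) • X k (s + 1)) (q : ℕ) :
    (D ^ q) (X 0 0) = (q.factorial : ℂ) • ∑ p ∈ Finset.HasAntidiagonal.antidiagonal q,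
      (((Ring.choose (a - p.1) p.2 : ℤ) : ℂ) / (p.1.factorial : ℂ)) • X p.1 p.2 := by
  induction q with
  | zero => simp
  | succ q ih =>
    rw [pow_succ', Module.End.mul_apply, ih, map_smul, map_sum]
    simp only [map_smul, hD, smul_add, smul_smul, Finset.sum_add_distrib]
    -- `g₁` collects the contributions of X (k-1) s and `g₂` those of X k (s-1). Pascal's rule and
    -- `succ_mul_choose_succ` put `g₂` in a form that visibly vanishes at s = 0, and `g₁ + g₂` is
    -- (k+s) C(a-k, s)/k!, with k + s = q + 1.
    let g₁ : ℕ → ℕ → ℂ := fun k s =>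
      k * ((Ring.choose (a - k + 1) s : ℤ) : ℂ) / (k.factorial : ℂ)
    let g₂ : ℕ → ℕ → ℂ := fun k s =>
      (((s : ℤ) * Ring.choose (a - k) s - k * (Ring.choose (a - k + 1) s - Ring.choose (a - k) s) : ℤ) : ℂ)
        / (k.factorial : ℂ)
    have e₁ : ∑ p ∈ Finset.HasAntidiagonal.antidiagonal q,
        (((Ring.choose (a - p.1) p.2 : ℤ) : ℂ) / (p.1.factorial : ℂ)) • X (p.1 + 1) p.2 =
        ∑ p ∈ Finset.HasAntidiagonal.antidiagonal (q + 1), g₁ p.1 p.2 • X p.1 p.2 := by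
      rw [Finset.Nat.sum_antidiagonal_succ]
      simp only [g₁, Nat.cast_zero, zero_mul, zero_div, zero_smul, zero_add]
      refine Finset.sum_congr rfl fun p _ => ?_
      rw [Nat.factorial_succ, show a - ((p.1 + 1 : ℕ) : ℤ) + 1 = a - p.1 by push_cast; ring]
      congr 1
      have : (p.1 : ℂ) + 1 ≠ 0 := Nat.cast_add_one_ne_zero _
      have := Nat.cast_ne_zero (R := ℂ).mpr p.1.factorial_ne_zero
      push_cast
      field_simp
    have e₂ : ∑ p ∈ Finset.HasAntidiagonal.antidiagonal q,
        (((Ring.choose (a - p.1) p.2 : ℤ) : ℂ) / (p.1.factorial : ℂ) *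
          ((a - 2 * p.1 - p.2 : ℤ) : ℂ)) • X p.1 (p.2 + 1) =
        ∑ p ∈ Finset.HasAntidiagonal.antidiagonal (q + 1), g₂ p.1 p.2 • X p.1 p.2 := by
      rw [Finset.Nat.sum_antidiagonal_succ']
      simp only [g₂, Ring.choose_zero_right, Nat.cast_zero, sub_self, mul_zero, zero_mul,
        Int.cast_zero, zero_div, zero_smul, zero_add]
      refine Finset.sum_congr rfl fun p _ => ?_
      congr 1
      rw [div_mul_eq_mul_div, ← Int.cast_mul]
      congr 2
      have := succ_mul_choose_succ (a - p.1) p.2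
      rw [Ring.choose_succ_succ]
      push_cast
      linear_combination -this
    rw [e₁, e₂, ← smul_add, ← Finset.sum_add_distrib, Finset.smul_sum, Finset.smul_sum]
    refine Finset.sum_congr rfl fun p hp => ?_
    have hq : (q : ℂ) + 1 = p.1 + p.2 := by exact_mod_cast (Finset.HasAntidiagonal.mem_antidiagonal.mp hp).symm
    rw [← add_smul, smul_smul, smul_smul, Nat.factorial_succ]
    congr 1
    simp only [g₁, g₂]
    push_cast
    rw [hq]
    ring

/-- The Leibniz rule for the iterates of `L` on `T w`, in terms of the iterates of `ad L`. -/
lemma pow_apply_eq_sum_ad {M : Type*} [AddCommGroup M] [Module ℂ M] (L T : Module.End ℂ M)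
    (p : ℕ) (w : M) :
    (L ^ p) (T w) = (p.factorial : ℂ) • ∑ q ∈ Finset.HasAntidiagonal.antidiagonal p,
      (1 / ((q.1.factorial : ℂ) * (q.2.factorial : ℂ))) •
        (((LinearMap.mulLeft ℂ L - LinearMap.mulRight ℂ L) ^ q.1) T) ((L ^ q.2) w) := by
  -- Left multiplication by L is the sum of ad L and right multiplication by L, which commute; the
  -- binomial theorem applies.
  have hc : Commute (LinearMap.mulLeft ℂ L - LinearMap.mulRight ℂ L) (LinearMap.mulRight ℂ L) :=
    (LinearMap.commute_mulLeft_right L L).sub_left (Commute.refl _)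
  have h : (LinearMap.mulLeft ℂ L ^ p) T = (L ^ p) * T := by
    rw [LinearMap.pow_mulLeft, LinearMap.mulLeft_apply]
  rw [← Module.End.mul_apply, ← h, ← sub_add_cancel (LinearMap.mulLeft ℂ L) (LinearMap.mulRight ℂ L),
    hc.add_pow', LinearMap.sum_apply, LinearMap.sum_apply, Finset.smul_sum, add_sub_cancel_right]
  refine Finset.sum_congr rfl fun q hq => ?_
  rw [← Finset.HasAntidiagonal.mem_antidiagonal.mp hq, LinearMap.smul_apply, LinearMap.smul_apply,
    (hc.pow_pow q.1 q.2).eq, LinearMap.pow_mulRight, Module.End.mul_apply, LinearMap.mulRight_apply,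
    ← Nat.cast_smul_eq_nsmul ℂ, smul_smul, Nat.cast_add_choose, mul_one_div]
  rfl

end Combinatorics

/-! ### The action of powers of L(1) on the vectors v_n w -/

section GradedRepresentation

variable {V : Type*} [AddCommGroup V] [Module ℂ V] {𝒱 : VertexOperatorAlgebra V}
  {W : Type*} [AddCommGroup W] [Module ℂ W]

/-- The properties shared by the adjoint module (graded by `ℤ`) and the modules (graded by `ℂ`)
which govern the action of `L(1)` on the vectors `vₙ w`. -/
structure IsGradedRep (𝒱 : VertexOperatorAlgebra V) {κ : Type*} [CommRing κ] [DecidableEq κ]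
    (gr : κ → Submodule ℂ W) (Y : ℤ → V →ₗ[ℂ] W →ₗ[ℂ] W) : Prop where
  internal : DirectSum.IsInternal gr
  bot : ∀ h, ∃ K : ℕ, ∀ k ≥ K, gr (h - (k : κ)) = ⊥
  truncation : ∀ v w, ∃ N : ℤ, ∀ n ≥ N, Y n v w = 0
  mem : ∀ (n h : ℤ) (j : κ), ∀ v ∈ 𝒱.gr h, ∀ w ∈ gr j,
    Y n v w ∈ gr (j + ((h - n - 1 : ℤ) : κ))
  L_one_bracket : ∀ (n h : ℤ), ∀ v ∈ 𝒱.gr h, ∀ w, Y 2 𝒱.ω (Y n v w) =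
    Y n (𝒱.L 1 v) w + ((2 * h - n - 2 : ℤ) : ℂ) • Y (n + 1) v w + Y n v (Y 2 𝒱.ω w)

/-- Bracket with `L(1)`, extracted from the Jacobi identity. -/
lemma JacobiIdentity.bracket_two {W₁ W₂ W₃ : Type*} [AddCommGroup W₁] [Module ℂ W₁]
    [AddCommGroup W₂] [Module ℂ W₂] [AddCommGroup W₃] [Module ℂ W₃]
    {κ : Type*} [AddCommGroupWithOne κ]
    {Y₁ : ℤ → V →ₗ[ℂ] W₁ →ₗ[ℂ] W₁} {Y₂ : ℤ → V →ₗ[ℂ] W₂ →ₗ[ℂ] W₂}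
    {Y₃ : ℤ → V →ₗ[ℂ] W₃ →ₗ[ℂ] W₃} {I : κ → W₁ →ₗ[ℂ] W₂ →ₗ[ℂ] W₃}
    (hJ : JacobiIdentity Y₁ Y₂ Y₃ I) (v : V) (w₁ : W₁) (w₂ : W₂) (n : κ) :
    Y₃ 2 v (I n w₁ w₂) = I n w₁ (Y₂ 2 v w₂) + I (n + 2) (Y₁ 0 v w₁) w₂ +
      (2 : ℂ) • I (n + 1) (Y₁ 1 v w₁) w₂ + I n (Y₁ 2 v w₁) w₂ := by
  have h := hJ v w₁ w₂ 0 2 n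
  have hch : ∀ i ≥ 1, Ring.choose (0 : ℤ) i = 0 := fun i hi =>
    Ring.choose_zero_pos ℤ (by omega)
  have hch' : ∀ i, Ring.choose (2 : ℤ) i = (Nat.choose 2 i : ℤ) := fun i => by
    exact_mod_cast Ring.choose_natCast (R := ℤ) 2 i
  rw [finsum_eq_zero_only _ fun i hi => by simp [hch i hi],
    finsum_eq_zero_only _ fun i hi => by simp [hch i hi],
    finsum_eq_sum_of_support_subset (s := Finset.range 3)] at h
  · simp only [Finset.sum_range_succ, Finset.range_zero, Finset.sum_empty, hch',
      Ring.choose_zero_right, pow_zero, zpow_zero, mul_one, Nat.choose_zero_right,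
      Nat.choose_one_right, Nat.choose_self,
      Int.cast_one, one_smul, Nat.cast_zero, Nat.cast_one, Int.cast_zero, add_zero, sub_zero,
      zero_add, Nat.cast_ofNat, Int.cast_ofNat] at h
    rw [sub_eq_iff_eq_add.mp h, show (2 : κ) + n = n + 2 by rw [add_comm],
      show n + 2 - 1 = n + 1 by rw [add_sub_assoc, ← one_add_one_eq_two, add_sub_cancel_right],
      add_sub_cancel_right]
    abel
  · intro i hi
    by_contra hlt
    refine hi ?_
    have : 2 < i := by simp at hlt; omega
    simp [hch', Nat.choose_eq_zero_of_lt this]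

lemma VertexOperatorAlgebra.L_one_Y (𝒱 : VertexOperatorAlgebra V) (n h : ℤ) {v : V}
    (hv : v ∈ 𝒱.gr h) (w : V) : 𝒱.Y 2 𝒱.ω (𝒱.Y n v w) =
      𝒱.Y n (𝒱.L 1 v) w + ((2 * h - n - 2 : ℤ) : ℂ) • 𝒱.Y (n + 1) v w
        + 𝒱.Y n v (𝒱.Y 2 𝒱.ω w) := by
  rw [𝒱.jacobi.bracket_two, 𝒱.L_zero _ _ hv, 𝒱.L_neg_one_derivative,
    show n + 2 - 1 = n + 1 by ring]
  simp only [map_smul, LinearMap.smul_apply, VertexOperatorAlgebra.L, one_add_one_eq_two]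
  push_cast
  module

lemma VertexOperatorAlgebra.isGradedRep (𝒱 : VertexOperatorAlgebra V) :
    IsGradedRep 𝒱 𝒱.gr 𝒱.Y where
  internal := 𝒱.internal
  bot h := by
    obtain ⟨N, hN⟩ := 𝒱.lower
    exact ⟨(h - N + 1).toNat, fun k hk => hN _ (by omega)⟩
  truncation := 𝒱.truncation
  mem n h j v hv w hw := by
    have := 𝒱.Y_mem n hv hw
    rwa [show h + j - n - 1 = j + ((h - n - 1 : ℤ) : ℤ) by ring] at this
  L_one_bracket n h v hv w := 𝒱.L_one_Y n h hv w

lemma GradedAction.IsModule.L_one_Y {M : GradedAction 𝒱 W} (hM : M.IsModule) (n h : ℤ) {v : V}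
    (hv : v ∈ 𝒱.gr h) (w : W) : M.Y 2 𝒱.ω (M.Y n v w) =
      M.Y n (𝒱.L 1 v) w + ((2 * h - n - 2 : ℤ) : ℂ) • M.Y (n + 1) v w
        + M.Y n v (M.Y 2 𝒱.ω w) := by
  have hd := hM.L_neg_one_derivative (n + 2) v w
  simp only [VertexOperatorAlgebra.L, show (-1 : ℤ) + 1 = 0 from rfl] at hd
  rw [hM.jacobi.bracket_two, 𝒱.L_zero _ _ hv, hd, show n + 2 - 1 = n + 1 by ring]
  simp only [map_smul, LinearMap.smul_apply, VertexOperatorAlgebra.L, one_add_one_eq_two]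
  push_cast
  module

lemma GradedAction.IsModule.isGradedRep {M : GradedAction 𝒱 W} (hM : M.IsModule) :
    IsGradedRep 𝒱 M.gr M.Y where
  internal := hM.internal
  bot h := by
    obtain ⟨N, hN⟩ := hM.lower
    refine ⟨⌊h.re - N⌋₊ + 1, fun k hk => hN _ ?_⟩
    have := (Nat.floor_lt' (n := k) (by omega)).mp (Nat.lt_of_succ_le hk)
    simp only [Complex.sub_re, Complex.natCast_re]
    linarith
  truncation := M.truncation
  mem n h j v hv w hw := by
    have := hM.Y_mem n hv hw
    rwa [show (h : ℂ) + j - n - 1 = j + ((h - n - 1 : ℤ) : ℂ) by push_cast; ring] at this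
  L_one_bracket n h v hv w := hM.L_one_Y n h hv w

lemma VertexOperatorAlgebra.L_one_pow_mem (𝒱 : VertexOperatorAlgebra V) {h : ℤ} {v : V}
    (hv : v ∈ 𝒱.gr h) (k : ℕ) : (𝒱.L 1 ^ k) v ∈ 𝒱.gr (h - k) := by
  simpa using pow_mem_gr (fun _ _ hw => 𝒱.L_one_mem hw) hv k

/-- Since ω = L(-2)1 and both L(1) and L(-1) kill the vacuum, this is the Virasoro relation for L(1)
and L(-2), which has no central term. -/
lemma VertexOperatorAlgebra.L_one_ω (𝒱 : VertexOperatorAlgebra V) : 𝒱.L 1 𝒱.ω = 0 := by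
  have h := 𝒱.virasoro 1 (-2) 𝒱.vac
  have h2 := (𝒱.creation 𝒱.ω).1 2 (by norm_num)
  have h0 := (𝒱.creation 𝒱.ω).1 0 (by norm_num)
  have h1 := (𝒱.creation 𝒱.ω).2
  norm_num [h1, h2, h0] at h
  exact h

namespace IsGradedRep

variable {κ : Type*} [CommRing κ] [DecidableEq κ] {gr : κ → Submodule ℂ W}
  {Y : ℤ → V →ₗ[ℂ] W →ₗ[ℂ] W}

lemma L_one_mem (hR : IsGradedRep 𝒱 gr Y) {h : κ} {w : W} (hw : w ∈ gr h) :
    Y 2 𝒱.ω w ∈ gr (h - 1) := by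
  have := hR.mem 2 2 h _ 𝒱.ω_mem w hw
  rwa [show h + ((2 - 2 - 1 : ℤ) : κ) = h - 1 by push_cast; ring] at this

lemma L_one_pow_mem (hR : IsGradedRep 𝒱 gr Y) {h : κ} {w : W} (hw : w ∈ gr h) (k : ℕ) :
    (Y 2 𝒱.ω ^ k) w ∈ gr (h - (k : κ)) :=
  pow_mem_gr (fun _ _ hw => hR.L_one_mem hw) hw k

lemma exists_L_one_pow_eq_zero (hR : IsGradedRep 𝒱 gr Y) {h : κ} {w : W} (hw : w ∈ gr h) :
    ∃ K : ℕ, ∀ k ≥ K, (Y 2 𝒱.ω ^ k) w = 0 := by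
  obtain ⟨K, hK⟩ := hR.bot h
  refine ⟨K, fun k hk => ?_⟩
  have := hR.L_one_pow_mem hw k
  rwa [hK k hk, Submodule.mem_bot] at this

/-- Coefficient form of moving e^{xL(1)} past Y(v,x_0). The operators (L(1)^k v)_{n+s} form the
two-parameter family of `iterate_two_parameter` with a = 2h-n-2: L(1)^k v has weight h-k, so the
commutator with L(1) has coefficient 2(h-k)-(n+s)-2. -/
lemma L_one_pow_Y (hR : IsGradedRep 𝒱 gr Y) (n : ℤ) {h : ℤ} {v : V} (hv : v ∈ 𝒱.gr h) (w : W)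
    (p : ℕ) :
    (1 / (p.factorial : ℂ)) • (Y 2 𝒱.ω ^ p) (Y n v w) =
      ∑ q ∈ Finset.HasAntidiagonal.antidiagonal p, ∑ r ∈ Finset.HasAntidiagonal.antidiagonal q.1,
        (((Ring.choose (2 * h - n - 2 - r.1) r.2 : ℤ) : ℂ) /
          ((r.1.factorial : ℂ) * (q.2.factorial : ℂ))) •
          Y (n + (r.2 : ℤ)) ((𝒱.L 1 ^ r.1) v) ((Y 2 𝒱.ω ^ q.2) w) := by
  have hX := iterate_two_parameter
    (LinearMap.mulLeft ℂ (Y 2 𝒱.ω : Module.End ℂ W) - LinearMap.mulRight ℂ (Y 2 𝒱.ω : Module.End ℂ W))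
    (fun k s => Y (n + (s : ℤ)) ((𝒱.L 1 ^ k) v)) (2 * h - n - 2) (fun k s => by
      ext w
      have := hR.L_one_bracket (n + s) (h - k) _ (𝒱.L_one_pow_mem hv k) w
      simp only [LinearMap.sub_apply, LinearMap.mulLeft_apply, LinearMap.mulRight_apply,
        Module.End.mul_apply, LinearMap.add_apply, LinearMap.smul_apply]
      rw [this, add_sub_cancel_right, pow_succ', Module.End.mul_apply,
        show 2 * (h - k) - (n + s) - 2 = 2 * h - n - 2 - 2 * k - (s : ℤ) by ring,
        Nat.cast_succ, add_assoc n])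
  simp only [Nat.cast_zero, add_zero, pow_zero, Module.End.one_apply] at hX
  have hp := Nat.cast_ne_zero (R := ℂ).mpr p.factorial_ne_zero
  rw [pow_apply_eq_sum_ad, smul_smul, one_div_mul_cancel hp, one_smul]
  refine Finset.sum_congr rfl fun q _ => ?_
  have hq := Nat.cast_ne_zero (R := ℂ).mpr q.1.factorial_ne_zero
  rw [hX, LinearMap.smul_apply, LinearMap.sum_apply, smul_smul, Finset.smul_sum]
  refine Finset.sum_congr rfl fun r _ => ?_
  rw [LinearMap.smul_apply, smul_smul]
  congr 1
  field_simp

/-- The expansion of `F(e^{L(1)} vₙ w)`, where `F` is any family of linear maps. -/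
lemma sum_L_one_pow_Y (hR : IsGradedRep 𝒱 gr Y) (n : ℤ) {h : ℤ} {v : V} (hv : v ∈ 𝒱.gr h) (w : W)
    {N : Type*} [AddCommGroup N] [Module ℂ N] (F : ℕ → W →ₗ[ℂ] N) {K J S P : ℕ}
    (hK : ∀ k ≥ K, (𝒱.L 1 ^ k) v = 0) (hJ : ∀ j ≥ J, (Y 2 𝒱.ω ^ j) w = 0)
    (hS : ∀ s ≥ S, ∀ k j, Y (n + (s : ℤ)) ((𝒱.L 1 ^ k) v) ((Y 2 𝒱.ω ^ j) w) = 0)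
    (hP : K + S + J ≤ P) :
    ∑ p ∈ Finset.range P, (1 / (p.factorial : ℂ)) • F p ((Y 2 𝒱.ω ^ p) (Y n v w)) =
      ∑ k ∈ Finset.range K, ∑ j ∈ Finset.range J, ∑ s ∈ Finset.range S,
        (((Ring.choose (2 * h - n - 2 - k) s : ℤ) : ℂ) /
          ((k.factorial : ℂ) * (j.factorial : ℂ))) •
          F (k + s + j) (Y (n + (s : ℤ)) ((𝒱.L 1 ^ k) v) ((Y 2 𝒱.ω ^ j) w)) := by
  let T : ℕ → ℕ → ℕ → N := fun k j s =>
    (((Ring.choose (2 * h - n - 2 - k) s : ℤ) : ℂ) / ((k.factorial : ℂ) * (j.factorial : ℂ))) •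
      F (k + s + j) (Y (n + (s : ℤ)) ((𝒱.L 1 ^ k) v) ((Y 2 𝒱.ω ^ j) w))
  have TK : ∀ k ≥ K, ∀ j s, T k j s = 0 := fun k hk j s => by simp [T, hK k hk]
  have TJ : ∀ j ≥ J, ∀ k s, T k j s = 0 := fun j hj k s => by simp [T, hJ j hj]
  have TS : ∀ s ≥ S, ∀ k j, T k j s = 0 := fun s hs k j => by simp [T, hS s hs]
  calc ∑ p ∈ Finset.range P, (1 / (p.factorial : ℂ)) • F p ((Y 2 𝒱.ω ^ p) (Y n v w))
      = ∑ p ∈ Finset.range P, ∑ q ∈ Finset.HasAntidiagonal.antidiagonal p,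
          ∑ r ∈ Finset.HasAntidiagonal.antidiagonal q.1, T r.1 q.2 r.2 := by
        refine Finset.sum_congr rfl fun p _ => ?_
        rw [← map_smul, hR.L_one_pow_Y n hv, map_sum]
        refine Finset.sum_congr rfl fun q hq => ?_
        rw [map_sum]
        refine Finset.sum_congr rfl fun r hr => ?_
        rw [map_smul, ← Finset.HasAntidiagonal.mem_antidiagonal.mp hq,
          ← Finset.HasAntidiagonal.mem_antidiagonal.mp hr]
    _ = ∑ q ∈ Finset.range (K + S), ∑ j ∈ Finset.range J,
          ∑ r ∈ Finset.HasAntidiagonal.antidiagonal q, T r.1 j r.2 := by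
        refine sum_range_antidiagonal (fun q j => ∑ r ∈ Finset.HasAntidiagonal.antidiagonal q,
          T r.1 j r.2) (fun q hq j => Finset.sum_eq_zero fun r hr => ?_)
          (fun q j hj => Finset.sum_eq_zero fun r _ => TJ j hj _ _) hP
        -- If r.1 + r.2 ≥ K + S, then r.1 ≥ K or r.2 ≥ S, and either makes the term vanish.
        have := Finset.HasAntidiagonal.mem_antidiagonal.mp hr
        rcases lt_or_ge r.1 K with hk | hk
        · exact TS _ (by omega) _ _
        · exact TK _ hk _ _
    _ = ∑ j ∈ Finset.range J, ∑ k ∈ Finset.range K, ∑ s ∈ Finset.range S, T k j s := by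
        rw [Finset.sum_comm]
        refine Finset.sum_congr rfl fun j _ => ?_
        exact sum_range_antidiagonal (fun k s => T k j s) (fun k hk s => TK k hk j s)
          (fun k s hs => TS s hs k j) le_rfl
    _ = _ := Finset.sum_comm

end IsGradedRep

end GradedRepresentation

/-! ### The Jacobi identity for opposite operators -/

section OppositeJacobi

variable {V : Type*} [AddCommGroup V] [Module ℂ V] {𝒱 : VertexOperatorAlgebra V}
  {W₁ W₂ W₃ : Type*} [AddCommGroup W₁] [Module ℂ W₁] [AddCommGroup W₂] [Module ℂ W₂]
  [AddCommGroup W₃] [Module ℂ W₃]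

/-- The coefficients of `Y(e^{x L(1)} (-x⁻²)^{L(0)} v, x⁻¹)`. -/
noncomputable def oppositeVertex (𝒱 : VertexOperatorAlgebra V) (Y : ℤ → V →ₗ[ℂ] W₂ →ₗ[ℂ] W₃) (m : ℤ) :
    V →ₗ[ℂ] W₂ →ₗ[ℂ] W₃ :=
  oppositeCoeff 𝒱.gr 𝒱.internal (𝒱.L 1) (fun h : ℤ => (-1 : ℂ) ^ h) Y m

lemma oppositeCoeff_eq_sum {κ : Type*} [CommRing κ] [DecidableEq κ] {gr₁ : κ → Submodule ℂ W₁}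
    {Y₁ : ℤ → V →ₗ[ℂ] W₁ →ₗ[ℂ] W₁} (hR : IsGradedRep 𝒱 gr₁ Y₁) (c : κ → ℂ)
    (I : κ → W₁ →ₗ[ℂ] W₂ →ₗ[ℂ] W₃) (m : κ) {h : κ} {w₁ : W₁} (hw : w₁ ∈ gr₁ h) (w₂ : W₂) {K : ℕ}
    (hK : ∀ k ≥ K, (Y₁ 2 𝒱.ω ^ k) w₁ = 0) :
    oppositeCoeff gr₁ hR.internal (Y₁ 2 𝒱.ω) c I m w₁ w₂ =
      ∑ k ∈ Finset.range K, (c h / (k.factorial : ℂ)) •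
        I (2 * h - (k : κ) - m - 2) ((Y₁ 2 𝒱.ω ^ k) w₁) w₂ := by
  rw [oppositeCoeff_apply hR.internal _ c I m (fun _ _ hw => hR.L_one_mem hw) (hR.bot h) hw,
    finsum_eq_sum_of_support_subset]
  intro k hk
  by_contra hlt
  refine hk ?_
  simp only [Finset.coe_range, Set.mem_Iio, not_lt] at hlt
  simp [hK k hlt]

lemma oppositeVertex_eq_sum (Y : ℤ → V →ₗ[ℂ] W₂ →ₗ[ℂ] W₃) (m : ℤ) {h : ℤ} {v : V}
    (hv : v ∈ 𝒱.gr h) (w : W₂) {K : ℕ} (hK : ∀ k ≥ K, (𝒱.L 1 ^ k) v = 0) :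
    oppositeVertex 𝒱 Y m v w =
      ∑ k ∈ Finset.range K, ((-1 : ℂ) ^ h / (k.factorial : ℂ)) •
        Y (2 * h - (k : ℤ) - m - 2) ((𝒱.L 1 ^ k) v) w :=
  oppositeCoeff_eq_sum 𝒱.isGradedRep _ Y m hv w hK

/-- The Jacobi identity, with the sums extended over a sufficiently large range. -/
lemma JacobiIdentity.eventually {κ : Type*} [AddGroupWithOne κ]
    {Y₁ : ℤ → V →ₗ[ℂ] W₁ →ₗ[ℂ] W₁} {Y₂ : ℤ → V →ₗ[ℂ] W₂ →ₗ[ℂ] W₂}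
    {Y₃ : ℤ → V →ₗ[ℂ] W₃ →ₗ[ℂ] W₃} {I : κ → W₁ →ₗ[ℂ] W₂ →ₗ[ℂ] W₃}
    (hJ : JacobiIdentity Y₁ Y₂ Y₃ I)
    (t₁ : ∀ v w, ∃ N : ℤ, ∀ n ≥ N, Y₁ n v w = 0) (t₂ : ∀ v w, ∃ N : ℤ, ∀ n ≥ N, Y₂ n v w = 0)
    (tI : ∀ w₁ w₂ (n : κ), ∃ K : ℕ, ∀ i ≥ K, I (n + (i : κ)) w₁ w₂ = 0)
    (v : V) (w₁ : W₁) (w₂ : W₂) (l m : ℤ) (n : κ) :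
    ∀ᶠ N in Filter.atTop,
      (∑ i ∈ Finset.range N, ((-1 : ℂ) ^ i * ((Ring.choose l i : ℤ) : ℂ)) •
          Y₃ (m + l - (i : ℤ)) v (I (n + (i : κ)) w₁ w₂))
        - (∑ i ∈ Finset.range N, ((-1 : ℂ) ^ l * (-1 : ℂ) ^ i * ((Ring.choose l i : ℤ) : ℂ)) •
          I (n + (l : κ) - (i : κ)) w₁ (Y₂ (m + (i : ℤ)) v w₂))
        = ∑ i ∈ Finset.range N, ((Ring.choose m i : ℤ) : ℂ) •
          I ((m : κ) + n - (i : κ)) (Y₁ (l + (i : ℤ)) v w₁) w₂ := by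
  have h := hJ v w₁ w₂ l m n
  obtain ⟨K₁, hK₁⟩ := tI w₁ w₂ n
  obtain ⟨N₂, hN₂⟩ := t₂ v w₂
  obtain ⟨N₁, hN₁⟩ := t₁ v w₁
  filter_upwards [
    finsum_eventually_eq (fun i : ℕ => ((-1 : ℂ) ^ i * ((Ring.choose l i : ℤ) : ℂ)) •
      Y₃ (m + l - (i : ℤ)) v (I (n + (i : κ)) w₁ w₂)) ⟨K₁, fun i hi => by simp [hK₁ i hi]⟩,
    finsum_eventually_eq (fun i : ℕ => ((-1 : ℂ) ^ l * (-1 : ℂ) ^ i * ((Ring.choose l i : ℤ) : ℂ)) •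
      I (n + (l : κ) - (i : κ)) w₁ (Y₂ (m + (i : ℤ)) v w₂))
      ⟨(N₂ - m).toNat, fun i hi => by rw [hN₂ _ (by omega), map_zero, smul_zero]⟩,
    finsum_eventually_eq (fun i : ℕ => ((Ring.choose m i : ℤ) : ℂ) •
      I ((m : κ) + n - (i : κ)) (Y₁ (l + (i : ℤ)) v w₁) w₂)
      ⟨(N₁ - l).toNat, fun i hi => by
        rw [hN₁ _ (by omega), map_zero, LinearMap.zero_apply, smul_zero]⟩] with N e₁ e₂ e₃
  rw [← e₁, ← e₂, ← e₃, h]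

/-- The vector depends only on t = i + s, so grouping by antidiagonals exposes the alternating
Vandermonde sum. -/
lemma sum_sum_choose_smul {M : Type*} [AddCommGroup M] [Module ℂ M] (A m : ℤ) (G : ℕ → M)
    {S N : ℕ} (hG : ∀ t ≥ S, G t = 0) (hN : S ≤ N) :
    ∑ i ∈ Finset.range N, ∑ s ∈ Finset.range S,
      (((-1) ^ i * Ring.choose m i * Ring.choose (A - i) s : ℤ) : ℂ) • G (i + s) =
      ∑ t ∈ Finset.range N, ((Ring.choose (A - m) t : ℤ) : ℂ) • G t := by
  rw [← sum_range_antidiagonal (P := N + S) (fun i s : ℕ =>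
      (((-1) ^ i * Ring.choose m i * Ring.choose (A - i) s : ℤ) : ℂ) • G (i + s))
    (fun i hi s => by rw [hG _ (by omega), smul_zero])
    (fun i s hs => by rw [hG _ (by omega), smul_zero]) le_rfl,
    Finset.sum_subset (Finset.range_mono (Nat.le_add_right N S))
      fun t _ ht => by rw [hG t (by simp at ht; omega), smul_zero]]
  refine Finset.sum_congr rfl fun t _ => ?_
  rw [← sum_neg_one_pow_mul_choose, Int.cast_sum, Finset.sum_smul]
  refine Finset.sum_congr rfl fun p hp => ?_
  rw [Finset.HasAntidiagonal.mem_antidiagonal.mp hp]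

variable {κ : Type*} [CommRing κ] [DecidableEq κ] {gr₁ : κ → Submodule ℂ W₁}
  {Y₁ : ℤ → V →ₗ[ℂ] W₁ →ₗ[ℂ] W₁} {Y₂ : ℤ → V →ₗ[ℂ] W₂ →ₗ[ℂ] W₂}
  {Y₃ : ℤ → V →ₗ[ℂ] W₃ →ₗ[ℂ] W₃} {I : κ → W₁ →ₗ[ℂ] W₂ →ₗ[ℂ] W₃}

/-- The iterate term of the opposite Jacobi identity, in terms of the original operator. -/
lemma sum_oppositeCoeff_Y (hR : IsGradedRep 𝒱 gr₁ Y₁) {c : κ → ℂ}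
    (hc : ∀ (h : κ) (n : ℤ), c (h + (n : κ)) = (-1) ^ n * c h) {h : ℤ} {h' : κ} {v : V} {w₁ : W₁}
    (hv : v ∈ 𝒱.gr h) (hw₁ : w₁ ∈ gr₁ h') (w₂ : W₂) (l m : ℤ) (n : κ) {K J : ℕ}
    (hK : ∀ k ≥ K, (𝒱.L 1 ^ k) v = 0) (hJ : ∀ j ≥ J, (Y₁ 2 𝒱.ω ^ j) w₁ = 0) :
    ∀ᶠ N in Filter.atTop,
      ∑ i ∈ Finset.range N, ((Ring.choose m i : ℤ) : ℂ) •
        oppositeCoeff gr₁ hR.internal (Y₁ 2 𝒱.ω) c I ((m : κ) + n - (i : κ))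
          (Y₁ (l + (i : ℤ)) v w₁) w₂ =
      ∑ k ∈ Finset.range K, ∑ j ∈ Finset.range J,
        (-((-1) ^ h * (-1) ^ l * c h') / ((k.factorial : ℂ) * (j.factorial : ℂ))) •
        ∑ t ∈ Finset.range N, ((Ring.choose (2 * h - l - 2 - k - m) t : ℤ) : ℂ) •
          I (((2 * h - l - 2 - k - m : ℤ) : κ) + (2 * h' - (j : κ) - n - (l : κ) - 2) - (t : κ))
            (Y₁ (l + (t : ℤ)) ((𝒱.L 1 ^ k) v) ((Y₁ 2 𝒱.ω ^ j) w₁)) w₂ := by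
  -- A uniform bound exists because only the finitely many pairs k < K, j < J give nonzero vectors.
  obtain ⟨S, hS⟩ : ∃ S : ℕ, ∀ s ≥ S, ∀ k j,
      Y₁ (l + (s : ℤ)) ((𝒱.L 1 ^ k) v) ((Y₁ 2 𝒱.ω ^ j) w₁) = 0 := by
    choose N hN using fun k j => hR.truncation ((𝒱.L 1 ^ k) v) ((Y₁ 2 𝒱.ω ^ j) w₁)
    refine ⟨((Finset.range K ×ˢ Finset.range J).sup fun p => (N p.1 p.2 - l).toNat),
      fun s hs k j => ?_⟩
    rcases lt_or_ge k K with hk | hk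
    · rcases lt_or_ge j J with hj | hj
      · have := (Finset.le_sup (f := fun p : ℕ × ℕ => (N p.1 p.2 - l).toNat)
          (Finset.mk_mem_product (Finset.mem_range.mpr hk) (Finset.mem_range.mpr hj))).trans hs
        exact hN k j _ (by simp only [] at this; omega)
      · rw [hJ j hj, map_zero]
    · rw [hK k hk, map_zero, LinearMap.zero_apply]
  -- One bound serves all i: L(1)^p (v_{l+i} w₁) has weight h' + h - l - 1 - (i+p), which only
  -- decreases as i grows.
  obtain ⟨P₀, hP₀⟩ := hR.bot (h' + ((h - l - 1 : ℤ) : κ))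
  have hmem : ∀ i : ℕ, Y₁ (l + (i : ℤ)) v w₁ ∈ gr₁ (h' + ((h - (l + i) - 1 : ℤ) : κ)) :=
    fun i => hR.mem _ _ _ v hv w₁ hw₁
  let P := max P₀ (K + S + J)
  have hP : ∀ i : ℕ, ∀ p ≥ P, (Y₁ 2 𝒱.ω ^ p) (Y₁ (l + (i : ℤ)) v w₁) = 0 := fun i p hp => by
    have := hR.L_one_pow_mem (hmem i) p
    rwa [show h' + ((h - (l + i) - 1 : ℤ) : κ) - (p : κ) =
      h' + ((h - l - 1 : ℤ) : κ) - ((i + p : ℕ) : κ) by push_cast; ring,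
      hP₀ _ (by have := (le_max_left P₀ (K + S + J)).trans hp; omega), Submodule.mem_bot] at this
  let G : ℕ → ℕ → ℕ → W₃ := fun k j t =>
    I (((2 * h - l - 2 - k - m : ℤ) : κ) + (2 * h' - (j : κ) - n - (l : κ) - 2) - (t : κ))
      (Y₁ (l + (t : ℤ)) ((𝒱.L 1 ^ k) v) ((Y₁ 2 𝒱.ω ^ j) w₁)) w₂
  have hG : ∀ k j, ∀ t ≥ S, G k j t = 0 := fun k j t ht => by
    simp only [G]; rw [hS t ht, map_zero, LinearMap.zero_apply]
  filter_upwards [Filter.eventually_ge_atTop S] with N hN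
  -- After expanding e^{L(1)}(v_{l+i} w₁), the index of I is 2(h'+h-l-i-1) - (k+s+j) - (m+n-i) - 2.
  -- Here i and s enter only through i + s, so the vector is `G k j (i + s)`.
  have key : ∀ i : ℕ, oppositeCoeff gr₁ hR.internal (Y₁ 2 𝒱.ω) c I ((m : κ) + n - (i : κ))
      (Y₁ (l + (i : ℤ)) v w₁) w₂ = ∑ k ∈ Finset.range K, ∑ j ∈ Finset.range J,
        ∑ s ∈ Finset.range S, (-((-1) ^ h * (-1) ^ l * c h') /
          ((k.factorial : ℂ) * (j.factorial : ℂ)) *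
          (((-1) ^ i * Ring.choose (2 * h - l - 2 - k - i) s : ℤ) : ℂ)) • G k j (i + s) := by
    intro i
    rw [oppositeCoeff_eq_sum hR c I _ (hmem i) w₂ (hP i)]
    have hexp := hR.sum_L_one_pow_Y (l + i) hv w₁ (fun p => (I (2 * (h' + ((h - (l + i) - 1 : ℤ) : κ)) -
      (p : κ) - ((m : κ) + n - (i : κ)) - 2)).flip w₂) (P := P) hK hJ
      (fun s hs k j => by rw [add_assoc]; exact_mod_cast hS (i + s) (by omega) k j)
      (le_max_right _ _)
    -- The vector v_{l+i} w₁ has weight h' + (h-l-i-1). The rule for c produces the sign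
    -- (-1)^{h-l-i-1}, and inverse powers of -1 equal the powers themselves.
    have hcc : c (h' + ((h - (l + i) - 1 : ℤ) : κ)) = -((-1) ^ h * (-1) ^ l * c h') * (-1) ^ i := by
      rw [hc, show h - (l + i) - 1 = h - l - i - 1 by ring, zpow_sub_one₀ (by norm_num),
        zpow_sub₀ (by norm_num), zpow_sub₀ (by norm_num), zpow_natCast]
      have e1 : ((-1 : ℂ) ^ l)⁻¹ = (-1) ^ l := by rw [← inv_zpow, inv_neg_one]
      have e2 : ((-1 : ℂ) ^ i)⁻¹ = (-1) ^ i := by rw [← inv_pow, inv_neg_one]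
      rw [div_eq_mul_inv, div_eq_mul_inv, e1, e2, inv_neg_one]
      ring
    rw [hcc]
    simp only [LinearMap.flip_apply] at hexp
    have := congrArg ((-((-1) ^ h * (-1) ^ l * c h') * (-1) ^ i) • ·) hexp
    simp only [Finset.smul_sum, smul_smul, mul_one_div] at this
    rw [this]
    refine Finset.sum_congr rfl fun k _ => Finset.sum_congr rfl fun j _ =>
      Finset.sum_congr rfl fun s _ => ?_
    simp only [G]
    rw [show l + ((i + s : ℕ) : ℤ) = l + i + s by push_cast; ring,
      show 2 * h - (l + (i : ℤ)) - 2 - k = 2 * h - l - 2 - k - i by ring]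
    congr 1
    · push_cast; ring
    · congr 3
      push_cast; ring
  simp only [key, Finset.smul_sum, smul_smul]
  rw [Finset.sum_comm]
  refine Finset.sum_congr rfl fun k _ => ?_
  rw [Finset.sum_comm]
  refine Finset.sum_congr rfl fun j _ => ?_
  have := congrArg ((-((-1) ^ h * (-1) ^ l * c h') / ((k.factorial : ℂ) * (j.factorial : ℂ))) • ·)
    (sum_sum_choose_smul (2 * h - l - 2 - k) m (G k j) (hG k j) hN)
  simp only [Finset.smul_sum, smul_smul] at this
  rw [← this]
  refine Finset.sum_congr rfl fun i _ => Finset.sum_congr rfl fun s _ => ?_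
  congr 1
  push_cast
  ring

/-- It is the combination, with weights -(-1)^{h+l} c(h')/(k! j!), of the original identities for
L(1)^k v and L(1)^j w₁ with the same l and with m, n replaced by 2h-l-2-k-m and 2h'-j-n-l-2. The
iterate terms agree by `sum_oppositeCoeff_Y`, and the two product terms change places. -/
lemma JacobiIdentity.opposite_of_mem (hR : IsGradedRep 𝒱 gr₁ Y₁) {c : κ → ℂ}
    (hc : ∀ (h : κ) (n : ℤ), c (h + (n : κ)) = (-1) ^ n * c h)
    (hI : JacobiIdentity Y₁ Y₂ Y₃ I) (t₂ : ∀ v w, ∃ N : ℤ, ∀ n ≥ N, Y₂ n v w = 0)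
    (tI : ∀ w₁ w₂ (n : κ), ∃ K : ℕ, ∀ i ≥ K, I (n + (i : κ)) w₁ w₂ = 0)
    {h : ℤ} {h' : κ} {v : V} {w₁ : W₁}
    (hv : v ∈ 𝒱.gr h) (hw₁ : w₁ ∈ gr₁ h') (w₂ : W₂) (l m : ℤ) (n : κ) :
    ∀ᶠ N in Filter.atTop,
      (∑ i ∈ Finset.range N, ((-1 : ℂ) ^ i * ((Ring.choose l i : ℤ) : ℂ)) •
          oppositeCoeff gr₁ hR.internal (Y₁ 2 𝒱.ω) c I (n + (i : κ)) w₁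
            (oppositeVertex 𝒱 Y₂ (m + l - (i : ℤ)) v w₂))
        - (∑ i ∈ Finset.range N, ((-1 : ℂ) ^ l * (-1 : ℂ) ^ i * ((Ring.choose l i : ℤ) : ℂ)) •
          oppositeVertex 𝒱 Y₃ (m + (i : ℤ)) v
            (oppositeCoeff gr₁ hR.internal (Y₁ 2 𝒱.ω) c I (n + (l : κ) - (i : κ)) w₁ w₂))
        = ∑ i ∈ Finset.range N, ((Ring.choose m i : ℤ) : ℂ) •
          oppositeCoeff gr₁ hR.internal (Y₁ 2 𝒱.ω) c I ((m : κ) + n - (i : κ))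
            (Y₁ (l + (i : ℤ)) v w₁) w₂ := by
  obtain ⟨K, hK⟩ : ∃ K : ℕ, ∀ k ≥ K, (𝒱.L 1 ^ k) v = 0 :=
    𝒱.isGradedRep.exists_L_one_pow_eq_zero hv
  obtain ⟨J, hJ⟩ := hR.exists_L_one_pow_eq_zero hw₁
  -- The new indices are forced by the product terms: m'+l-i = 2h-k-(m+i)-2 and n'+i =
  -- 2h'-j-(n+l-i)-2, which are the indices occurring in the opposite coefficients.
  have horig : ∀ᶠ N in Filter.atTop, ∀ k ∈ Finset.range K, ∀ j ∈ Finset.range J, _ :=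
    (Finset.eventually_all _).mpr fun k _ => (Finset.eventually_all _).mpr fun j _ =>
      hI.eventually hR.truncation t₂ tI ((𝒱.L 1 ^ k) v) ((Y₁ 2 𝒱.ω ^ j) w₁) w₂ l
        (2 * h - l - 2 - k - m) (2 * h' - (j : κ) - n - (l : κ) - 2)
  filter_upwards [horig, sum_oppositeCoeff_Y (I := I) hR hc hv hw₁ w₂ l m n hK hJ] with N hN h₃
  have hl : (-1 : ℂ) ^ l * (-1) ^ l = 1 := by
    rw [← mul_zpow, neg_one_mul, neg_neg, one_zpow]
  rw [h₃]
  simp only [oppositeCoeff_eq_sum hR c I _ hw₁ _ hJ, oppositeVertex_eq_sum _ _ hv _ hK]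
  have hsub : ∀ k ∈ Finset.range K, ∀ j ∈ Finset.range J, _ := fun k hk j hj =>
    congrArg ((-((-1) ^ h * (-1) ^ l * c h') / ((k.factorial : ℂ) * (j.factorial : ℂ))) • ·)
      (hN k hk j hj)
  rw [← Finset.sum_congr rfl fun k hk => Finset.sum_congr rfl fun j hj => hsub k hk j hj]
  simp only [smul_sub, Finset.sum_sub_distrib, Finset.smul_sum, smul_smul, map_sum, map_smul]
  -- Each opposite product is minus the rescaled original product in the other position. In one of
  -- the two cases this uses (-1)^l (-1)^l = 1.
  have hswap : ∀ a b c d : W₃, a = -d → b = -c → a - b = c - d := by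
    rintro _ _ c d rfl rfl
    abel
  have hcomm : ∀ X : ℕ → ℕ → ℕ → W₃,
      ∑ i ∈ Finset.range N, ∑ j ∈ Finset.range J, ∑ k ∈ Finset.range K, X i j k =
        ∑ k ∈ Finset.range K, ∑ j ∈ Finset.range J, ∑ i ∈ Finset.range N, X i j k := fun X => by
    rw [Finset.sum_comm, Finset.sum_congr rfl fun j _ => Finset.sum_comm]
    exact Finset.sum_comm
  refine hswap _ _ _ _ ?_ ?_
  · simp only [← Finset.sum_neg_distrib, ← neg_smul]
    rw [hcomm]
    refine Finset.sum_congr rfl fun k _ => Finset.sum_congr rfl fun j _ =>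
      Finset.sum_congr rfl fun i _ => ?_
    congr 1
    · linear_combination (-((-1) ^ h * (-1) ^ i * ((Ring.choose l i : ℤ) : ℂ) * c h' /
        ((k.factorial : ℂ) * (j.factorial : ℂ)))) * hl
    · rw [show 2 * h - l - 2 - k - m + (i : ℤ) = 2 * h - k - (m + l - i) - 2 by ring]
      congr 3
      ring
  · simp only [← Finset.sum_neg_distrib, ← neg_smul]
    rw [Finset.sum_comm]
    refine Finset.sum_congr rfl fun k _ => ?_
    rw [Finset.sum_comm]
    refine Finset.sum_congr rfl fun j _ => Finset.sum_congr rfl fun i _ => ?_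
    congr 1
    · ring
    · rw [show 2 * h - l - 2 - k - m + l - (i : ℤ) = 2 * h - k - (m + i) - 2 by ring]
      congr 4
      ring

/-- Both sides are additive in v and in w₁, and the eventual form survives sums, so homogeneous
vectors suffice. -/
lemma JacobiIdentity.opposite (hR : IsGradedRep 𝒱 gr₁ Y₁) {c : κ → ℂ}
    (hc : ∀ (h : κ) (n : ℤ), c (h + (n : κ)) = (-1) ^ n * c h)
    (hI : JacobiIdentity Y₁ Y₂ Y₃ I) (t₂ : ∀ v w, ∃ N : ℤ, ∀ n ≥ N, Y₂ n v w = 0)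
    (tI : ∀ w₁ w₂ (n : κ), ∃ K : ℕ, ∀ i ≥ K, I (n + (i : κ)) w₁ w₂ = 0)
    (v : V) (w₁ : W₁) (w₂ : W₂) (l m : ℤ) (n : κ) :
    ∀ᶠ N in Filter.atTop,
      (∑ i ∈ Finset.range N, ((-1 : ℂ) ^ i * ((Ring.choose l i : ℤ) : ℂ)) •
          oppositeCoeff gr₁ hR.internal (Y₁ 2 𝒱.ω) c I (n + (i : κ)) w₁
            (oppositeVertex 𝒱 Y₂ (m + l - (i : ℤ)) v w₂))
        - (∑ i ∈ Finset.range N, ((-1 : ℂ) ^ l * (-1 : ℂ) ^ i * ((Ring.choose l i : ℤ) : ℂ)) •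
          oppositeVertex 𝒱 Y₃ (m + (i : ℤ)) v
            (oppositeCoeff gr₁ hR.internal (Y₁ 2 𝒱.ω) c I (n + (l : κ) - (i : κ)) w₁ w₂))
        = ∑ i ∈ Finset.range N, ((Ring.choose m i : ℤ) : ℂ) •
          oppositeCoeff gr₁ hR.internal (Y₁ 2 𝒱.ω) c I ((m : κ) + n - (i : κ))
            (Y₁ (l + (i : ℤ)) v w₁) w₂ := by
  induction v using graded_induction 𝒱.internal with
  | hom h v hv =>
    induction w₁ using graded_induction hR.internal with
    | hom h' w₁ hw₁ => exact hI.opposite_of_mem hR hc t₂ tI hv hw₁ w₂ l m n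
    | zero => simp
    | add x y hx hy =>
      filter_upwards [hx, hy] with N ex ey
      simp only [map_add, LinearMap.add_apply, smul_add, Finset.sum_add_distrib, ← ex, ← ey]
      abel
  | zero => simp
  | add x y hx hy =>
    filter_upwards [hx, hy] with N ex ey
    simp only [map_add, LinearMap.add_apply, smul_add, Finset.sum_add_distrib, ← ex, ← ey]
    abel

/-- The Jacobi identity for the transposed operators on the restricted duals. -/
lemma JacobiIdentity.of_opposite {gr₂ : ℂ → Submodule ℂ W₂} {gr₃ : ℂ → Submodule ℂ W₃}
    {κ : Type*} [AddGroupWithOne κ]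
    {Z₂ : ℤ → V →ₗ[ℂ] W₂ →ₗ[ℂ] W₂} {Z₃ : ℤ → V →ₗ[ℂ] W₃ →ₗ[ℂ] W₃} {J : κ → W₁ →ₗ[ℂ] W₂ →ₗ[ℂ] W₃}
    (hJ : ∀ (v : V) (w₁ : W₁) (w₂ : W₂) (l m : ℤ) (n : κ), ∀ᶠ N in Filter.atTop,
      (∑ i ∈ Finset.range N, ((-1 : ℂ) ^ i * ((Ring.choose l i : ℤ) : ℂ)) •
          J (n + (i : κ)) w₁ (Z₂ (m + l - (i : ℤ)) v w₂))
        - (∑ i ∈ Finset.range N, ((-1 : ℂ) ^ l * (-1 : ℂ) ^ i * ((Ring.choose l i : ℤ) : ℂ)) •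
          Z₃ (m + (i : ℤ)) v (J (n + (l : κ) - (i : κ)) w₁ w₂))
        = ∑ i ∈ Finset.range N, ((Ring.choose m i : ℤ) : ℂ) •
          J ((m : κ) + n - (i : κ)) (Y₁ (l + (i : ℤ)) v w₁) w₂)
    {Z₂' : ℤ → V →ₗ[ℂ] restrictedDual gr₂ →ₗ[ℂ] restrictedDual gr₂}
    {Z₃' : ℤ → V →ₗ[ℂ] restrictedDual gr₃ →ₗ[ℂ] restrictedDual gr₃}
    {J' : κ → W₁ →ₗ[ℂ] restrictedDual gr₃ →ₗ[ℂ] restrictedDual gr₂}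
    (h₂ : ∀ n v f w, (Z₂' n v f).1 w = f.1 (Z₂ n v w))
    (h₃ : ∀ n v f w, (Z₃' n v f).1 w = f.1 (Z₃ n v w))
    (hJ' : ∀ n w₁ f w₂, (J' n w₁ f).1 w₂ = f.1 (J n w₁ w₂))
    (t₁ : ∀ v w, ∃ N : ℤ, ∀ n ≥ N, Y₁ n v w = 0) (t₃ : ∀ v f, ∃ N : ℤ, ∀ n ≥ N, Z₃' n v f = 0)
    (tJ : ∀ w₁ f (n : κ), ∃ K : ℕ, ∀ i ≥ K, J' (n + (i : κ)) w₁ f = 0) :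
    JacobiIdentity Y₁ Z₃' Z₂' J' := by
  intro v w₁ f l m n
  apply Subtype.ext
  ext w₂
  obtain ⟨K, hK⟩ := tJ w₁ f n
  obtain ⟨N₃, hN₃⟩ := t₃ v f
  obtain ⟨N₁, hN₁⟩ := t₁ v w₁
  -- A single N at which the undualized identity holds and all three dual sums are exhausted.
  -- Evaluating f at that identity gives the claim, since transposition reverses each product.
  obtain ⟨N, hN, e₁, e₂, e₃⟩ := ((hJ v w₁ w₂ l m n).and <|
    (finsum_eventually_eq (fun i : ℕ => ((-1 : ℂ) ^ i * ((Ring.choose l i : ℤ) : ℂ)) •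
      Z₂' (m + l - (i : ℤ)) v (J' (n + (i : κ)) w₁ f)) ⟨K, fun i hi => by simp [hK i hi]⟩).and <|
    (finsum_eventually_eq (fun i : ℕ => ((-1 : ℂ) ^ l * (-1 : ℂ) ^ i * ((Ring.choose l i : ℤ) : ℂ)) •
      J' (n + (l : κ) - (i : κ)) w₁ (Z₃' (m + (i : ℤ)) v f))
      ⟨(N₃ - m).toNat, fun i hi => by rw [hN₃ _ (by omega), map_zero, smul_zero]⟩).and <|
    (finsum_eventually_eq (fun i : ℕ => ((Ring.choose m i : ℤ) : ℂ) •
      J' ((m : κ) + n - (i : κ)) (Y₁ (l + (i : ℤ)) v w₁) f)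
      ⟨(N₁ - l).toNat, fun i hi => by
        rw [hN₁ _ (by omega), map_zero, LinearMap.zero_apply, smul_zero]⟩)).exists
  have h := congrArg f.1 hN
  rw [e₁, e₂, e₃]
  simpa only [Submodule.coe_sub, Submodule.coe_sum, Submodule.coe_smul, LinearMap.sub_apply,
    LinearMap.sum_apply, LinearMap.smul_apply, h₂, h₃, hJ', map_sub, map_sum, map_smul] using h

end OppositeJacobi

/-! ### The derivative property and the inversion of opposite coefficients -/

section OppositeCoefficients

variable {V : Type*} [AddCommGroup V] [Module ℂ V] {𝒱 : VertexOperatorAlgebra V}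
  {W₁ W₂ W₃ : Type*} [AddCommGroup W₁] [Module ℂ W₁] [AddCommGroup W₂] [Module ℂ W₂]
  [AddCommGroup W₃] [Module ℂ W₃]
  {κ : Type*} [CommRing κ] [DecidableEq κ] {gr₁ : κ → Submodule ℂ W₁}
  {Y₁ : ℤ → V →ₗ[ℂ] W₁ →ₗ[ℂ] W₁} {I : κ → W₁ →ₗ[ℂ] W₂ →ₗ[ℂ] W₃}

/-- The sl_2 relation [L(1), L(-1)] = 2L(0), iterated: L(1)^i w has weight h-i, and the sum of
2(h-i) over 0 ≤ i ≤ k is (k+1)(2h-k). -/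
lemma IsGradedRep.L_one_pow_L_neg_one (hR : IsGradedRep 𝒱 gr₁ Y₁) (φ : κ →+* ℂ)
    (hφ : ∀ h, ∀ w ∈ gr₁ h, Y₁ 1 𝒱.ω w = φ h • w) {h : κ} {w : W₁} (hw : w ∈ gr₁ h) (k : ℕ) :
    (Y₁ 2 𝒱.ω ^ (k + 1)) (Y₁ 0 𝒱.ω w) = Y₁ 0 𝒱.ω ((Y₁ 2 𝒱.ω ^ (k + 1)) w) +
      (((k : ℂ) + 1) * (2 * φ h - k)) • (Y₁ 2 𝒱.ω ^ k) w := by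
  -- The relation is the bracket formula applied to v = ω, of weight 2, together with L(1)ω = 0.
  have hb : ∀ u, Y₁ 2 𝒱.ω (Y₁ 0 𝒱.ω u) =
      (2 : ℂ) • Y₁ 1 𝒱.ω u + Y₁ 0 𝒱.ω (Y₁ 2 𝒱.ω u) := fun u => by
    have := hR.L_one_bracket 0 2 _ 𝒱.ω_mem u
    rw [this, 𝒱.L_one_ω, map_zero, LinearMap.zero_apply, zero_add, zero_add]
    norm_num
  induction k with
  | zero =>
    simp only [zero_add, pow_one, pow_zero, Module.End.one_apply, Nat.cast_zero]
    rw [hb, hφ h w hw, smul_smul, add_comm]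
    congr 2
    ring
  | succ k ih =>
    have hk := hφ _ _ (hR.L_one_pow_mem hw (k + 1))
    have hk' : Y₁ 2 𝒱.ω ((Y₁ 2 𝒱.ω ^ k) w) = (Y₁ 2 𝒱.ω ^ (k + 1)) w := by
      rw [pow_succ', Module.End.mul_apply]
    rw [pow_succ', Module.End.mul_apply, ih, map_add, hb, hk, map_smul, hk', Module.End.mul_apply]
    simp only [map_sub, map_natCast]
    push_cast
    module

/-- Commuting L(-1) to the left of L(1)^k gives, at each k, the factor -(2h-k-m) from the derivative
property of I and 2h-k from the sl_2 commutator. They add up to m, and c(h+1) = -c(h) supplies the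
sign. -/
lemma oppositeCoeff_L_neg_one (hR : IsGradedRep 𝒱 gr₁ Y₁) {c : κ → ℂ}
    (hc : ∀ (h : κ) (n : ℤ), c (h + (n : κ)) = (-1) ^ n * c h) (φ : κ →+* ℂ)
    (hφ : ∀ h, ∀ w ∈ gr₁ h, Y₁ 1 𝒱.ω w = φ h • w)
    (hI : ∀ n w₁ w₂, I n (Y₁ 0 𝒱.ω w₁) w₂ = -φ n • I (n - 1) w₁ w₂) (m : κ) (w₁ : W₁) (w₂ : W₂) :
    oppositeCoeff gr₁ hR.internal (Y₁ 2 𝒱.ω) c I m (Y₁ 0 𝒱.ω w₁) w₂ =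
      -φ m • oppositeCoeff gr₁ hR.internal (Y₁ 2 𝒱.ω) c I (m - 1) w₁ w₂ := by
  induction w₁ using graded_induction hR.internal with
  | hom h w hw =>
    obtain ⟨K, hK⟩ := hR.exists_L_one_pow_eq_zero hw
    have hw' : Y₁ 0 𝒱.ω w ∈ gr₁ (h + ((1 : ℤ) : κ)) := by
      simpa using hR.mem 0 2 h _ 𝒱.ω_mem w hw
    have hcomm := hR.L_one_pow_L_neg_one φ hφ hw
    rw [oppositeCoeff_eq_sum hR c I m hw' w₂ (K := K + 1) (fun k hk => by
        obtain ⟨k, rfl⟩ : ∃ k', k = k' + 1 := ⟨k - 1, by omega⟩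
        rw [hcomm, hK k (by omega), hK (k + 1) (by omega), map_zero, smul_zero, add_zero]),
      oppositeCoeff_eq_sum hR c I (m - 1) hw w₂ hK, hc h 1, zpow_one, Finset.sum_range_succ']
    simp only [hcomm, map_add, LinearMap.add_apply, smul_add, Finset.sum_add_distrib, hI]
    rw [add_right_comm, pow_zero, Module.End.one_apply, hI]
    -- Reunites the split-off k = 0 term with the shifted sum; the top term k = K vanishes by the
    -- choice of K.
    have hshift := Finset.sum_range_succ' (fun k : ℕ => (-1 * c h / (k.factorial : ℂ)) •
      -φ (2 * (h + ((1 : ℤ) : κ)) - (k : κ) - m - 2) •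
        I (2 * (h + ((1 : ℤ) : κ)) - (k : κ) - m - 2 - 1) ((Y₁ 2 𝒱.ω ^ k) w) w₂) K
    rw [Finset.sum_range_succ, hK K le_rfl] at hshift
    simp only [pow_zero, Module.End.one_apply, map_zero, LinearMap.zero_apply, smul_zero,
      add_zero] at hshift
    rw [← hshift, ← Finset.sum_add_distrib, Finset.smul_sum]
    refine Finset.sum_congr rfl fun k _ => ?_
    rw [map_smul, LinearMap.smul_apply, smul_smul, smul_smul, smul_smul,
      show 2 * (h + ((1 : ℤ) : κ)) - (k : κ) - m - 2 - 1 = 2 * h - (k : κ) - (m - 1) - 2 by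
        push_cast; ring,
      show 2 * (h + ((1 : ℤ) : κ)) - ((k + 1 : ℕ) : κ) - m - 2 = 2 * h - (k : κ) - (m - 1) - 2 by
        push_cast; ring, ← add_smul, Nat.factorial_succ]
    congr 1
    have := Nat.cast_ne_zero (R := ℂ).mpr k.factorial_ne_zero
    have := Nat.cast_add_one_ne_zero (R := ℂ) k
    simp only [map_sub, map_mul, map_add, map_natCast, map_ofNat, map_intCast]
    push_cast
    field_simp
    ring
  | zero => simp
  | add x y hx hy => simp only [map_add, LinearMap.add_apply, hx, hy, smul_add]

/-- The coefficient of x^p in e^{-x} e^x = 1. -/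
lemma sum_antidiagonal_neg_one_pow_div (p : ℕ) :
    ∑ q ∈ Finset.HasAntidiagonal.antidiagonal p,
      (-1 : ℂ) ^ q.1 / ((q.1.factorial : ℂ) * (q.2.factorial : ℂ)) = if p = 0 then 1 else 0 := by
  have h := (Commute.all (-1 : ℂ) 1).add_pow' p
  rw [neg_add_cancel, zero_pow_eq] at h
  have hp := Nat.cast_ne_zero (R := ℂ).mpr p.factorial_ne_zero
  rw [← mul_right_inj' hp, Finset.mul_sum]
  trans (if p = 0 then (1 : ℂ) else 0)
  · rw [h]
    refine Finset.sum_congr rfl fun q hq => ?_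
    rw [← Finset.HasAntidiagonal.mem_antidiagonal.mp hq, nsmul_eq_mul, Nat.cast_add_choose]
    ring
  · split_ifs with h0
    · subst h0; simp
    · simp

/-- Since L(1)^k w has weight h-k, the inner scalar is (-1)^k c(h), which turns the outer
exponential into e^{-xL(1)}. The index of I becomes m-(k+j), so terms group by k + j and only k = j
= 0 survives. -/
lemma oppositeCoeff_oppositeCoeff (hR : IsGradedRep 𝒱 gr₁ Y₁) {c c' : κ → ℂ}
    (hc : ∀ (h : κ) (n : ℤ), c (h + (n : κ)) = (-1) ^ n * c h) (hcc : ∀ h, c' h * c h = 1)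
    (m : κ) (w₁ : W₁) (w₂ : W₂) :
    oppositeCoeff gr₁ hR.internal (Y₁ 2 𝒱.ω) c'
      (oppositeCoeff gr₁ hR.internal (Y₁ 2 𝒱.ω) c I) m w₁ w₂ = I m w₁ w₂ := by
  induction w₁ using graded_induction hR.internal with
  | hom h w hw =>
    obtain ⟨K, hK⟩ := hR.exists_L_one_pow_eq_zero hw
    have hK' : ∀ k, ∀ j ≥ K, (Y₁ 2 𝒱.ω ^ j) ((Y₁ 2 𝒱.ω ^ k) w) = 0 := fun k j hj => by
      rw [← Module.End.mul_apply, ← pow_add, hK _ (by omega)]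
    let g : ℕ → ℕ → W₃ := fun k j => ((-1 : ℂ) ^ k / ((k.factorial : ℂ) * (j.factorial : ℂ))) •
      I (m - ((k + j : ℕ) : κ)) ((Y₁ 2 𝒱.ω ^ (k + j)) w) w₂
    have hg : ∀ k j, K ≤ k + j → g k j = 0 := fun k j hkj => by simp [g, hK _ hkj]
    have h1 : oppositeCoeff gr₁ hR.internal (Y₁ 2 𝒱.ω) c'
        (oppositeCoeff gr₁ hR.internal (Y₁ 2 𝒱.ω) c I) m w w₂ =
        ∑ k ∈ Finset.range K, ∑ j ∈ Finset.range K, g k j := by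
      rw [oppositeCoeff_eq_sum hR c' _ m hw w₂ hK]
      refine Finset.sum_congr rfl fun k _ => ?_
      rw [oppositeCoeff_eq_sum hR c I _ (hR.L_one_pow_mem hw k) w₂ (hK' k), Finset.smul_sum]
      refine Finset.sum_congr rfl fun j _ => ?_
      have hck : c (h - (k : κ)) = (-1) ^ k * c h := by
        have := hc h (-(k : ℤ))
        rwa [zpow_neg, zpow_natCast, ← inv_pow, inv_neg_one, Int.cast_neg, Int.cast_natCast,
          ← sub_eq_add_neg] at this
      simp only [g]
      rw [smul_smul, hck, add_comm k j, pow_add, Module.End.mul_apply]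
      congr 1
      · rw [div_mul_div_comm, mul_left_comm, hcc, mul_one]
      · congr 3
        push_cast
        ring
    rw [h1, ← sum_range_antidiagonal g (P := K + K + 1) (fun a ha b => hg a b (by omega))
      (fun a b hb => hg a b (by omega)) (by omega)]
    have h2 : ∀ p, ∑ q ∈ Finset.HasAntidiagonal.antidiagonal p, g q.1 q.2 =
        if p = 0 then I m w w₂ else 0 := fun p => by
      have : ∀ q ∈ Finset.HasAntidiagonal.antidiagonal p, g q.1 q.2 =
          ((-1 : ℂ) ^ q.1 / ((q.1.factorial : ℂ) * (q.2.factorial : ℂ))) •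
            I (m - (p : κ)) ((Y₁ 2 𝒱.ω ^ p) w) w₂ := fun q hq => by
        rw [← Finset.HasAntidiagonal.mem_antidiagonal.mp hq]
      rw [Finset.sum_congr rfl this, ← Finset.sum_smul, sum_antidiagonal_neg_one_pow_div]
      split_ifs with h0
      · subst h0; simp
      · simp
    simp [h2]
  | zero => simp
  | add x y hx hy => simp only [map_add, LinearMap.add_apply, hx, hy]

/-- `oppositeCoeff` is natural in the operator. -/
lemma oppositeCoeff_congr {W₂' W₃' N : Type*} [AddCommGroup W₂'] [Module ℂ W₂'] [AddCommGroup W₃']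
    [Module ℂ W₃'] [AddCommGroup N] [Module ℂ N] (hR : IsGradedRep 𝒱 gr₁ Y₁) (c : κ → ℂ)
    {I' : κ → W₁ →ₗ[ℂ] W₂' →ₗ[ℂ] W₃'} (φ : W₃ →ₗ[ℂ] N) (ψ : W₃' →ₗ[ℂ] N) (x : W₂) (y : W₂')
    (h : ∀ q u, φ (I q u x) = ψ (I' q u y)) (m : κ) (w₁ : W₁) :
    φ (oppositeCoeff gr₁ hR.internal (Y₁ 2 𝒱.ω) c I m w₁ x) =
      ψ (oppositeCoeff gr₁ hR.internal (Y₁ 2 𝒱.ω) c I' m w₁ y) := by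
  induction w₁ using graded_induction hR.internal with
  | hom j w hw =>
    obtain ⟨K, hK⟩ := hR.exists_L_one_pow_eq_zero hw
    simp only [oppositeCoeff_eq_sum hR c _ m hw _ hK, map_sum, map_smul, h]
  | zero => simp
  | add u v hu hv => simp only [map_add, LinearMap.add_apply, hu, hv]

end OppositeCoefficients

/-! ### The grading of the restricted dual -/

section RestrictedDual

variable {W : Type*} [AddCommGroup W] [Module ℂ W] {gr : ℂ → Submodule ℂ W}

lemma restrictedDual_ext (hgr : DirectSum.IsInternal gr) {f g : restrictedDual gr}
    (h : ∀ n, ∀ w ∈ gr n, f.1 w = g.1 w) : f = g := by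
  apply Subtype.ext
  ext w
  induction w using graded_induction hgr with
  | hom n w hw => exact h n w hw
  | zero => simp
  | add x y hx hy => simp only [map_add, hx, hy]

lemma dualGrading_isInternal (hgr : DirectSum.IsInternal gr) :
    DirectSum.IsInternal (dualGrading gr) := by
  refine DirectSum.isInternal_submodule_of_iSupIndep_of_iSup_eq_top (fun n => ?_)
    (eq_top_iff.mpr fun f _ => restrictedDual_le_span gr hgr f)
  rw [Submodule.disjoint_def]
  intro f hf hf'
  -- The functionals that vanish on W_(n). They contain every other weight space of the dual, while
  -- an element of weight n that lies in `S` is zero.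
  let S : Submodule ℂ (restrictedDual gr) :=
    { carrier := {f | ∀ w ∈ gr n, f.1 w = 0}
      add_mem' := fun ha hb w hw => by simp [ha w hw, hb w hw]
      zero_mem' := fun _ _ => rfl
      smul_mem' := fun c _ ha w hw => by simp [ha w hw] }
  have hS : ⨆ j, ⨆ (_ : j ≠ n), dualGrading gr j ≤ S :=
    iSup₂_le fun j hj g hg w hw => hg n hj.symm w hw
  refine restrictedDual_ext hgr fun m w hw => ?_
  by_cases hm : m = n
  · subst hm
    exact hS hf' w hw
  · exact hf m hm w hw

lemma dualGrading_finiteDimensional (hgr : DirectSum.IsInternal gr) (n : ℂ)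
    [FiniteDimensional ℂ (gr n)] : FiniteDimensional ℂ (dualGrading gr n) := by
  let T : dualGrading gr n →ₗ[ℂ] Dual ℂ (gr n) :=
    { toFun := fun f => f.1.1 ∘ₗ (gr n).subtype
      map_add' := fun _ _ => rfl
      map_smul' := fun _ _ => rfl }
  refine FiniteDimensional.of_injective T fun f g hfg => Subtype.ext ?_
  refine restrictedDual_ext hgr fun m w hw => ?_
  by_cases hm : m = n
  · subst hm
    exact LinearMap.congr_fun hfg ⟨w, hw⟩
  · rw [f.2 m hm w hw, g.2 m hm w hw]

lemma dualGrading_eq_bot (hgr : DirectSum.IsInternal gr) {n : ℂ} (hn : gr n = ⊥) :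
    dualGrading gr n = ⊥ := by
  refine (Submodule.eq_bot_iff _).mpr fun f hf => restrictedDual_ext hgr fun m w hw => ?_
  by_cases hm : m = n
  · subst hm
    rw [hn, Submodule.mem_bot] at hw
    rw [hw, map_zero, map_zero]
  · exact hf m hm w hw

end RestrictedDual

variable {V : Type*} [AddCommGroup V] [Module ℂ V] {𝒱 : VertexOperatorAlgebra V}
  {W W₁ W₂ W₃ : Type*} [AddCommGroup W] [Module ℂ W] [AddCommGroup W₁] [Module ℂ W₁]
  [AddCommGroup W₂] [Module ℂ W₂] [AddCommGroup W₃] [Module ℂ W₃]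

/-! ### The contragredient module -/

section ContragredientModule

lemma neg_one_zpow_add (h n : ℤ) : (-1 : ℂ) ^ (h + ((n : ℤ) : ℤ)) = (-1) ^ n * (-1) ^ h := by
  rw [zpow_add₀ (by norm_num), mul_comm]

lemma contragredient_Y_eq (M : GradedAction 𝒱 W) (hM : M.IsModule) (n : ℤ) (v : V)
    (f : restrictedDual M.gr) (w : W) :
    ((M.contragredient hM).Y n v f).1 w = f.1 (oppositeVertex 𝒱 M.Y n v w) := rfl

/-- As L(1)ω = 0, only the k = 0 term survives, and ω has the even weight 2, so there is no sign. -/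
lemma contragredient_L (M : GradedAction 𝒱 W) (hM : M.IsModule) (n : ℤ)
    (f : restrictedDual M.gr) (w : W) :
    ((M.contragredient hM).L n f).1 w = f.1 (M.L (-n) w) := by
  rw [GradedAction.L, contragredient_Y_eq,
    oppositeVertex_eq_sum M.Y (n + 1) 𝒱.ω_mem w (K := 1) (fun k hk => by
      obtain ⟨k, rfl⟩ : ∃ k', k = k' + 1 := ⟨k - 1, by omega⟩
      rw [pow_succ, Module.End.mul_apply, 𝒱.L_one_ω, map_zero])]
  simp only [Finset.sum_range_one, Nat.factorial_zero, pow_zero, Module.End.one_apply]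
  rw [show 2 * 2 - ((0 : ℕ) : ℤ) - (n + 1) - 2 = -n + 1 by push_cast; ring]
  norm_num
  rfl

lemma oppositeVertex_vac (M : GradedAction 𝒱 W) (n : ℤ) (w : W) :
    oppositeVertex 𝒱 M.Y n 𝒱.vac w = M.Y (-n - 2) 𝒱.vac w := by
  rw [oppositeVertex_eq_sum M.Y n 𝒱.vac_mem w (K := 1) (fun k hk => by
      obtain ⟨k, rfl⟩ : ∃ k', k = k' + 1 := ⟨k - 1, by omega⟩
      rw [pow_succ, Module.End.mul_apply, VertexOperatorAlgebra.L,
        (𝒱.creation 𝒱.ω).1 _ (by norm_num), map_zero])]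
  simp only [Finset.sum_range_one, Nat.factorial_zero, pow_zero, Module.End.one_apply]
  rw [show 2 * 0 - ((0 : ℕ) : ℤ) - n - 2 = -n - 2 by push_cast; ring]
  norm_num

/-- The contragredient of a module is a module. -/
theorem GradedAction.IsModule.contragredient {M : GradedAction 𝒱 W} (hM : M.IsModule) :
    (M.contragredient hM).IsModule where
  internal := dualGrading_isInternal hM.internal
  finite n := by
    have := hM.finite n
    exact dualGrading_finiteDimensional hM.internal n
  lower := by
    obtain ⟨N, hN⟩ := hM.lower
    exact ⟨N, fun n hn => dualGrading_eq_bot hM.internal (hN n hn)⟩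
  vacuum n f := by
    apply Subtype.ext
    ext w
    rw [contragredient_Y_eq, oppositeVertex_vac, hM.vacuum]
    by_cases hn : n = -1
    · subst hn
      simp
    · rw [if_neg hn, if_neg (by omega)]
      simp
  jacobi := JacobiIdentity.of_opposite (Z₂ := oppositeVertex 𝒱 M.Y) (Z₃ := oppositeVertex 𝒱 M.Y)
    (J := oppositeVertex 𝒱 M.Y)
    (fun v u w l m n => hM.jacobi.opposite 𝒱.isGradedRep neg_one_zpow_add M.truncation
      (fun u w n => by
        obtain ⟨N, hN⟩ := M.truncation u w
        exact ⟨(N - n).toNat, fun i hi => hN _ (by omega)⟩) v u w l m n)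
    (contragredient_Y_eq M hM) (contragredient_Y_eq M hM) (contragredient_Y_eq M hM)
    𝒱.truncation (M.contragredient hM).truncation (fun u f n => by
        obtain ⟨N, hN⟩ := (M.contragredient hM).truncation u f
        exact ⟨(N - n).toNat, fun i hi => hN _ (by omega)⟩)
  virasoro m n f := by
    apply Subtype.ext
    ext w
    -- Transposition reverses products, so [L'(m), L'(n)] is the transpose of [L(-n), L(-m)]; both
    -- the factor m-n and the central term are unchanged.
    have h := congrArg f.1 (hM.virasoro (-n) (-m) w)
    simp only [map_sub, map_add, map_smul] at h
    simp only [Submodule.coe_sub, Submodule.coe_add, Submodule.coe_smul, LinearMap.sub_apply,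
      LinearMap.add_apply, LinearMap.smul_apply, contragredient_L]
    rw [h, neg_add]
    rw [add_comm (-n) (-m)]
    congr 1
    · push_cast
      congr 1
      ring
    · by_cases hmn : m + n = 0
      · obtain rfl : n = -m := by omega
        simp
      · rw [if_neg hmn, if_neg (by omega)]
  L_zero n f hf := by
    refine restrictedDual_ext hM.internal fun m w hw => ?_
    rw [contragredient_L, neg_zero, hM.L_zero m w hw, map_smul]
    by_cases hm : m = n
    · subst hm; rfl
    · rw [hf m hm w hw]
      simp [hf m hm w hw]
  L_neg_one_derivative n v f := by
    apply Subtype.ext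
    ext w
    have h := oppositeCoeff_L_neg_one 𝒱.isGradedRep neg_one_zpow_add (Int.castRingHom ℂ)
      (by simpa using 𝒱.L_zero) (I := M.Y) (fun n u w => hM.L_neg_one_derivative n u w) n v w
    exact (congrArg f.1 h).trans (by rw [map_smul]; rfl)

end ContragredientModule

/-! ### The operators A_r -/

section ContragredientOperator

/-- The integer 2r+1 is odd, so e^{(2r+1)πi} = -1. -/
lemma exp_weight_add (r : ℤ) (h : ℂ) (n : ℤ) :
    Complex.exp ((2 * r + 1) * Real.pi * Complex.I * (h + (n : ℂ))) =
      (-1) ^ n * Complex.exp ((2 * r + 1) * Real.pi * Complex.I * h) := by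
  have h1 : Complex.exp ((2 * r + 1) * Real.pi * Complex.I * (n : ℂ)) = (-1) ^ n := by
    rw [show (2 * (r : ℂ) + 1) * Real.pi * Complex.I * n =
        (((2 * r + 1) * n : ℤ) : ℂ) * (Real.pi * Complex.I) by push_cast; ring,
      Complex.exp_int_mul, Complex.exp_pi_mul_I, zpow_mul, (odd_two_mul_add_one r).neg_one_zpow]
  rw [mul_add, Complex.exp_add, h1, mul_comm]

lemma exp_weight_mul (r s : ℤ) (hrs : r + s = -1) (h : ℂ) :
    Complex.exp ((2 * r + 1) * Real.pi * Complex.I * h) *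
      Complex.exp ((2 * s + 1) * Real.pi * Complex.I * h) = 1 := by
  obtain rfl : s = -r - 1 := by omega
  rw [← Complex.exp_add]
  convert Complex.exp_zero using 2
  push_cast
  ring

variable {M₁ : GradedAction 𝒱 W₁} {M₂ : GradedAction 𝒱 W₂} {M₃ : GradedAction 𝒱 W₃}

lemma contragredientOperator_eq (h₁ : M₁.IsModule) (r : ℤ) {gr₂ : ℂ → Submodule ℂ W₂}
    {gr₃ : ℂ → Submodule ℂ W₃} (I : gradedOperators M₁.gr gr₂ gr₃) (n : ℂ) (w₁ : W₁)
    (f : restrictedDual gr₃) (w₂ : W₂) :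
    ((contragredientOperator h₁ r I).1 n w₁ f).1 w₂ = f.1 (oppositeOperator h₁ r I.1 n w₁ w₂) := rfl

/-- A functional sees finitely many weights and the weights of W₂ are bounded below. For w₁ of
weight h and w₂ of weight j, the value has weight j-h+n+1, whose real part exceeds all weights seen
by f once that of n is large. -/
lemma contragredientOperator_truncation (h₁ : M₁.IsModule) (h₂ : M₂.IsModule) (r : ℤ)
    {gr₃ : ℂ → Submodule ℂ W₃} (I : gradedOperators M₁.gr M₂.gr gr₃) (w₁ : W₁)
    (f : restrictedDual gr₃) :
    ∃ N : ℝ, ∀ n : ℂ, N ≤ n.re → (contragredientOperator h₁ r I).1 n w₁ f = 0 := by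
  induction w₁ using graded_induction h₁.internal with
  | hom h w₁ hw₁ =>
    have hf : {n : ℂ | ∃ w ∈ gr₃ n, f.1 w ≠ 0}.Finite := f.2
    obtain ⟨B, hB⟩ := (hf.image Complex.re).bddAbove
    obtain ⟨N₀, hN₀⟩ := h₂.lower
    refine ⟨B - N₀ + h.re, fun n hn => restrictedDual_ext h₂.internal fun j w hw => ?_⟩
    rw [contragredientOperator_eq]
    by_contra hne
    have h3 := hB ⟨_, ⟨_, oppositeOperator_mem h₁ r I n h j w₁ hw₁ w hw, hne⟩, rfl⟩
    have h4 : N₀ ≤ j.re := by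
      by_contra hlt
      have h5 := hN₀ j (not_le.mp hlt)
      rw [h5, Submodule.mem_bot] at hw
      exact hne (by rw [hw, map_zero, map_zero, map_zero])
    simp at h3
    linarith
  | zero => exact ⟨0, fun n _ => by simp⟩
  | add x y hx hy =>
    obtain ⟨N, hN⟩ := hx
    obtain ⟨N', hN'⟩ := hy
    refine ⟨max N N', fun n hn => ?_⟩
    rw [map_add, LinearMap.add_apply, hN n (le_trans (le_max_left _ _) hn),
      hN' n (le_trans (le_max_right _ _) hn), add_zero]

lemma exists_nat_of_re_truncated {M : Type*} [Zero M] {F : ℂ → M}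
    (h : ∃ N : ℝ, ∀ n : ℂ, N ≤ n.re → F n = 0) (n : ℂ) :
    ∃ K : ℕ, ∀ i ≥ K, F (n + (i : ℂ)) = 0 := by
  obtain ⟨N, hN⟩ := h
  refine ⟨⌈N - n.re⌉₊, fun i hi => hN _ ?_⟩
  have := Nat.ceil_le.mp hi
  simp only [Complex.add_re, Complex.natCast_re]
  linarith

/-- The `r`-contragredient of an intertwining operator is an intertwining operator. -/
theorem contragredientOperator_mem (h₁ : M₁.IsModule) (h₂ : M₂.IsModule) (h₃ : M₃.IsModule)
    (r : ℤ) (I : intertwiningOperators M₁ M₂ M₃) :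
    (contragredientOperator h₁ r (toGraded h₁ h₂ h₃ I)).1 ∈
      intertwiningOperators M₁ (M₃.contragredient h₃) (M₂.contragredient h₂) where
  truncation := contragredientOperator_truncation h₁ h₂ r _
  jacobi := JacobiIdentity.of_opposite (Z₂ := oppositeVertex 𝒱 M₂.Y)
    (Z₃ := oppositeVertex 𝒱 M₃.Y) (J := oppositeOperator h₁ r I.1)
    (fun v w₁ w₂ l m n => I.2.jacobi.opposite h₁.isGradedRep (exp_weight_add r) M₂.truncation
      (fun w₁ w₂ n => exists_nat_of_re_truncated (I.2.truncation w₁ w₂) n) v w₁ w₂ l m n)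
    (contragredient_Y_eq M₂ h₂) (contragredient_Y_eq M₃ h₃)
    (contragredientOperator_eq h₁ r (toGraded h₁ h₂ h₃ I)) M₁.truncation
    (M₃.contragredient h₃).truncation
    (fun w₁ f n => exists_nat_of_re_truncated
      (contragredientOperator_truncation h₁ h₂ r (toGraded h₁ h₂ h₃ I) w₁ f) n)
  L_neg_one_derivative n w₁ f := by
    apply Subtype.ext
    ext w₂
    have h := oppositeCoeff_L_neg_one h₁.isGradedRep
      (c := fun h => Complex.exp ((2 * r + 1) * Real.pi * Complex.I * h))
      (exp_weight_add r) (RingHom.id ℂ)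
      h₁.L_zero (I := I.1) I.2.L_neg_one_derivative n w₁ w₂
    exact (congrArg f.1 h).trans (by rw [map_smul]; rfl)

/-- `A_s(A_r(I)) = I` if `r + s = -1`, for graded operators. -/
theorem contragredientOperator_contragredientOperator (h₁ : M₁.IsModule)
    {gr₂ : ℂ → Submodule ℂ W₂} {gr₃ : ℂ → Submodule ℂ W₃}
    (hgr₂ : DirectSum.IsInternal gr₂) (hfin₂ : ∀ n, FiniteDimensional ℂ (gr₂ n))
    (hgr₃ : DirectSum.IsInternal gr₃) (hfin₃ : ∀ n, FiniteDimensional ℂ (gr₃ n))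
    {r s : ℤ} (hrs : r + s = -1) (I : gradedOperators M₁.gr gr₂ gr₃) (n : ℂ) (w₁ : W₁) (w₂ : W₂) :
    (contragredientOperator h₁ s (contragredientOperator h₁ r I)).1 n w₁
        (bidualEquiv gr₂ hgr₂ hfin₂ w₂) = bidualEquiv gr₃ hgr₃ hfin₃ (I.1 n w₁ w₂) := by
  apply Subtype.ext
  ext f
  -- Naturality moves the pairing with f through the outer opposite coefficients, so that they act
  -- on the opposite of I itself instead of on its transpose.
  have h := oppositeCoeff_congr h₁.isGradedRep
    (fun h : ℂ => Complex.exp ((2 * s + 1) * Real.pi * Complex.I * h))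
    (I := (contragredientOperator h₁ r I).1) (I' := oppositeOperator h₁ r I.1)
    (LinearMap.applyₗ w₂ ∘ₗ (restrictedDual gr₂).subtype) f.1 f w₂ (fun _ _ => rfl) n w₁
  refine Eq.trans h ?_
  exact congrArg f.1 (oppositeCoeff_oppositeCoeff h₁.isGradedRep (exp_weight_add r)
    (exp_weight_mul s r (by omega)) n w₁ w₂)

/-- The canonical identification `W ≃ W''` is an isomorphism of modules. -/
theorem contragredient_contragredient_Y {M : GradedAction 𝒱 W} (hM : M.IsModule) (n : ℤ) (v : V)
    (w : W) :
    ((M.contragredient hM).contragredient hM.contragredient).Y n v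
        (bidualEquiv M.gr hM.internal hM.finite w) =
      bidualEquiv M.gr hM.internal hM.finite (M.Y n v w) := by
  apply Subtype.ext
  ext f
  have h := oppositeCoeff_congr 𝒱.isGradedRep (fun h : ℤ => (-1 : ℂ) ^ h)
    (I := (M.contragredient hM).Y) (I' := oppositeVertex 𝒱 M.Y)
    (LinearMap.applyₗ w ∘ₗ (restrictedDual M.gr).subtype) f.1 f w (fun _ _ => rfl) n v
  refine Eq.trans h ?_
  exact congrArg f.1 (oppositeCoeff_oppositeCoeff 𝒱.isGradedRep neg_one_zpow_add
    (fun h => by rw [← mul_zpow, neg_one_mul, neg_neg, one_zpow]) n v w)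

/-- Transport of an intertwining operator along isomorphisms of modules. -/
theorem IsIntertwiningOperator.transport {W₂' W₃' : Type*} [AddCommGroup W₂'] [Module ℂ W₂']
    [AddCommGroup W₃'] [Module ℂ W₃'] {M₂' : GradedAction 𝒱 W₂'} {M₃' : GradedAction 𝒱 W₃'}
    {J : ℂ → W₁ →ₗ[ℂ] W₂' →ₗ[ℂ] W₃'} (hJ : IsIntertwiningOperator M₁ M₂' M₃' J)
    (e₂ : W₂ ≃ₗ[ℂ] W₂') (e₃ : W₃ ≃ₗ[ℂ] W₃')
    (he₂ : ∀ n v w, M₂'.Y n v (e₂ w) = e₂ (M₂.Y n v w))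
    (he₃ : ∀ n v w, M₃'.Y n v (e₃ w) = e₃ (M₃.Y n v w))
    {I : ℂ → W₁ →ₗ[ℂ] W₂ →ₗ[ℂ] W₃} (hI : ∀ n w₁ w₂, e₃ (I n w₁ w₂) = J n w₁ (e₂ w₂)) :
    IsIntertwiningOperator M₁ M₂ M₃ I where
  truncation w₁ w₂ := by
    obtain ⟨N, hN⟩ := hJ.truncation w₁ (e₂ w₂)
    exact ⟨N, fun n hn => e₃.injective (by rw [hI, hN n hn, map_zero])⟩
  jacobi v w₁ w₂ l m n := by
    have hfs : ∀ F : ℕ → W₃, e₃ (∑ᶠ i, F i) = ∑ᶠ i, e₃ (F i) := fun F =>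
      e₃.toAddEquiv.map_finsum F
    apply e₃.injective
    simp only [map_sub, hfs, map_smul, hI, ← he₃, ← he₂]
    exact hJ.jacobi v w₁ (e₂ w₂) l m n
  L_neg_one_derivative n w₁ w₂ := e₃.injective (by
    rw [hI, hJ.L_neg_one_derivative, map_smul, hI])

lemma oppositeOperator_add (h₁ : M₁.IsModule) (r : ℤ) (I J : ℂ → W₁ →ₗ[ℂ] W₂ →ₗ[ℂ] W₃) (n : ℂ)
    (w₁ : W₁) (w₂ : W₂) : oppositeOperator h₁ r (I + J) n w₁ w₂ =
      oppositeOperator h₁ r I n w₁ w₂ + oppositeOperator h₁ r J n w₁ w₂ := by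
  -- Naturality compares only two operators at a time. Pairing I and J into one operator makes I, J
  -- and I + J its images under the two projections and the sum map.
  let K : ℂ → W₁ →ₗ[ℂ] W₂ × W₂ →ₗ[ℂ] W₃ × W₃ := fun n =>
    LinearMap.mk₂ ℂ (fun w x => (I n w x.1, J n w x.2)) (by simp) (by simp) (by simp) (by simp)
  let c : ℂ → ℂ := fun h => Complex.exp ((2 * r + 1) * Real.pi * Complex.I * h)
  have h := oppositeCoeff_congr h₁.isGradedRep c (I := I + J) (I' := K) LinearMap.id
    (LinearMap.coprod LinearMap.id LinearMap.id) w₂ (w₂, w₂) (fun _ _ => by simp [K]) n w₁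
  have hl := oppositeCoeff_congr h₁.isGradedRep c (I := I) (I' := K) LinearMap.id
    (LinearMap.fst ℂ W₃ W₃) w₂ (w₂, w₂) (fun _ _ => by simp [K]) n w₁
  have hr := oppositeCoeff_congr h₁.isGradedRep c (I := J) (I' := K) LinearMap.id
    (LinearMap.snd ℂ W₃ W₃) w₂ (w₂, w₂) (fun _ _ => by simp [K]) n w₁
  refine h.trans ?_
  rw [LinearMap.coprod_apply]
  exact (congrArg₂ (· + ·) hl hr).symm

lemma oppositeOperator_smul (h₁ : M₁.IsModule) (r : ℤ) (a : ℂ) (I : ℂ → W₁ →ₗ[ℂ] W₂ →ₗ[ℂ] W₃)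
    (n : ℂ) (w₁ : W₁) (w₂ : W₂) :
    oppositeOperator h₁ r (a • I) n w₁ w₂ = a • oppositeOperator h₁ r I n w₁ w₂ := by
  have h := oppositeCoeff_congr h₁.isGradedRep
    (fun h : ℂ => Complex.exp ((2 * r + 1) * Real.pi * Complex.I * h)) (I := a • I) (I' := I)
    LinearMap.id (a • LinearMap.id) w₂ w₂ (fun _ _ => by simp) n w₁
  exact h

/-- `A_r`, as a linear map between spaces of intertwining operators. -/
noncomputable def contragredientOperatorMap (h₁ : M₁.IsModule) (h₂ : M₂.IsModule) (h₃ : M₃.IsModule) (r : ℤ) :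
    intertwiningOperators M₁ M₂ M₃ →ₗ[ℂ]
      intertwiningOperators M₁ (M₃.contragredient h₃) (M₂.contragredient h₂) where
  toFun I := ⟨_, contragredientOperator_mem h₁ h₂ h₃ r I⟩
  map_add' I J := by
    apply Subtype.ext
    funext n
    ext w₁ f w₂
    exact (congrArg f.1 (oppositeOperator_add h₁ r I.1 J.1 n w₁ w₂)).trans (map_add f.1 _ _)
  map_smul' a I := by
    apply Subtype.ext
    funext n
    ext w₁ f w₂
    exact (congrArg f.1 (oppositeOperator_smul h₁ r a I.1 n w₁ w₂)).trans (map_smul f.1 _ _)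

/-- Up to the injective map W₃ → W₃'', the operator A_{-r-1} is a left inverse. -/
lemma contragredientOperatorMap_injective (h₁ : M₁.IsModule) (h₂ : M₂.IsModule)
    (h₃ : M₃.IsModule) (r : ℤ) :
    Function.Injective (contragredientOperatorMap h₁ h₂ h₃ r) := by
  intro I J hIJ
  have hval := congrArg Subtype.val hIJ
  have h : contragredientOperator h₁ r (toGraded h₁ h₂ h₃ I) =
      contragredientOperator h₁ r (toGraded h₁ h₂ h₃ J) := Subtype.ext hval
  apply Subtype.ext
  funext n
  ext w₁ w₂
  apply (bidualEquiv M₃.gr h₃.internal h₃.finite).injective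
  have hinv := fun I => contragredientOperator_contragredientOperator h₁ h₂.internal h₂.finite
    h₃.internal h₃.finite (r := r) (s := -r - 1) (by omega) (toGraded h₁ h₂ h₃ I) n w₁ w₂
  exact (hinv I).symm.trans (by rw [h]; exact hinv J)

/-- The preimage of J is A_{-r-1}(J), of type (W₃''; W₁ W₂''), transported back to W₂ and W₃ along
the bidual identifications, which respect the action of V. -/
lemma contragredientOperatorMap_surjective (h₁ : M₁.IsModule) (h₂ : M₂.IsModule)
    (h₃ : M₃.IsModule) (r : ℤ) :
    Function.Surjective (contragredientOperatorMap h₁ h₂ h₃ r) := by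
  intro J
  let e₂ := bidualEquiv M₂.gr h₂.internal h₂.finite
  let e₃ := bidualEquiv M₃.gr h₃.internal h₃.finite
  let A := contragredientOperator h₁ (-r - 1) (toGraded h₁ h₃.contragredient h₂.contragredient J)
  let I : ℂ → W₁ →ₗ[ℂ] W₂ →ₗ[ℂ] W₃ := fun n =>
    (A.1 n).compl₁₂ LinearMap.id e₂.toLinearMap |>.compr₂ e₃.symm.toLinearMap
  have hI : ∀ n w₁ w₂, e₃ (I n w₁ w₂) = A.1 n w₁ (e₂ w₂) := fun n w₁ w₂ =>
    e₃.apply_symm_apply _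
  have hmem : I ∈ intertwiningOperators M₁ M₂ M₃ :=
    IsIntertwiningOperator.transport (contragredientOperator_mem h₁ h₃.contragredient
      h₂.contragredient (-r - 1) J) e₂ e₃ (contragredient_contragredient_Y h₂)
      (contragredient_contragredient_Y h₃) hI
  refine ⟨⟨I, hmem⟩, ?_⟩
  apply Subtype.ext
  funext n
  ext w₁ f w₂
  -- The transported operator paired with f is the opposite of J applied to f and evaluated at w₂.
  -- Naturality then reduces the claim to inverting the opposite coefficients of J.
  have hIf : ∀ q u, f.1 (I q u w₂) = (oppositeOperator h₁ (-r - 1) J.1 q u f).1 w₂ := fun q u =>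
    congrArg (fun φ => φ.1 f) (hI q u w₂)
  have h := oppositeCoeff_congr h₁.isGradedRep
    (fun h : ℂ => Complex.exp ((2 * r + 1) * Real.pi * Complex.I * h)) (I := I)
    (I' := oppositeOperator h₁ (-r - 1) J.1) f.1
    (LinearMap.applyₗ w₂ ∘ₗ (restrictedDual M₂.gr).subtype) w₂ f hIf n w₁
  refine Eq.trans h ?_
  exact congrArg (fun g : restrictedDual M₂.gr => g.1 w₂) (oppositeCoeff_oppositeCoeff h₁.isGradedRep
    (exp_weight_add (-r - 1)) (exp_weight_mul r (-r - 1) (by omega)) n w₁ f)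

end ContragredientOperator

end VOA

/-! ### The proposition and the equality of fusion rules -/

theorem proposition7p3 {V W₁ W₂ W₃ : Type*} [AddCommGroup V] [Module ℂ V]
    [AddCommGroup W₁] [Module ℂ W₁] [AddCommGroup W₂] [Module ℂ W₂]
    [AddCommGroup W₃] [Module ℂ W₃] (𝒱 : VOA.VertexOperatorAlgebra V)
    (M₁ : VOA.GradedAction 𝒱 W₁) (M₂ : VOA.GradedAction 𝒱 W₂) (M₃ : VOA.GradedAction 𝒱 W₃)
    (h₁ : M₁.IsModule) (h₂ : M₂.IsModule) (h₃ : M₃.IsModule) (r : ℤ) :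
    -- the contragredients `W₂'` and `W₃'` are modules
    (M₂.contragredient h₂).IsModule ∧ (M₃.contragredient h₃).IsModule ∧
    -- `A_r(𝒴)` is an intertwining operator of type `(W₂'; W₁ W₃')`
    (∀ I : VOA.intertwiningOperators M₁ M₂ M₃,
      (VOA.contragredientOperator h₁ r (VOA.toGraded h₁ h₂ h₃ I)).1 ∈
        VOA.intertwiningOperators M₁ (M₃.contragredient h₃) (M₂.contragredient h₂)) ∧
    -- `A_{-r-1}(A_r(𝒴)) = 𝒴`, under the canonical identifications `W₂ ≃ W₂''` and `W₃ ≃ W₃''`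
    (∀ (I : VOA.intertwiningOperators M₁ M₂ M₃) (n : ℂ) (w₁ : W₁) (w₂ : W₂),
      (VOA.contragredientOperator h₁ (-r - 1)
          (VOA.contragredientOperator h₁ r (VOA.toGraded h₁ h₂ h₃ I))).1 n w₁
          (VOA.bidualEquiv M₂.gr h₂.internal h₂.finite w₂) =
        VOA.bidualEquiv M₃.gr h₃.internal h₃.finite (I.1 n w₁ w₂)) ∧
    -- `A_r(A_{-r-1}(𝒴)) = 𝒴`
    (∀ (I : VOA.intertwiningOperators M₁ M₂ M₃) (n : ℂ) (w₁ : W₁) (w₂ : W₂),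
      (VOA.contragredientOperator h₁ r
          (VOA.contragredientOperator h₁ (-r - 1) (VOA.toGraded h₁ h₂ h₃ I))).1 n w₁
          (VOA.bidualEquiv M₂.gr h₂.internal h₂.finite w₂) =
        VOA.bidualEquiv M₃.gr h₃.internal h₃.finite (I.1 n w₁ w₂)) ∧
    -- `𝒴 ↦ A_r(𝒴)` is a linear isomorphism of the spaces of intertwining operators
    (∃ e : VOA.intertwiningOperators M₁ M₂ M₃ ≃ₗ[ℂ]
        VOA.intertwiningOperators M₁ (M₃.contragredient h₃) (M₂.contragredient h₂),
      ∀ I, (e I).1 = (VOA.contragredientOperator h₁ r (VOA.toGraded h₁ h₂ h₃ I)).1) ∧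
    -- equality of the fusion rules
    VOA.fusionRule M₁ M₂ M₃ =
      VOA.fusionRule M₁ (M₃.contragredient h₃) (M₂.contragredient h₂) := by
  refine ⟨h₂.contragredient, h₃.contragredient,
    VOA.contragredientOperator_mem h₁ h₂ h₃ r, fun I => ?_, fun I => ?_, ?_, ?_⟩
  · exact VOA.contragredientOperator_contragredientOperator h₁ _ _ _ _ (by omega) _
  · exact VOA.contragredientOperator_contragredientOperator h₁ _ _ _ _ (by omega) _
  · exact ⟨LinearEquiv.ofBijective (VOA.contragredientOperatorMap h₁ h₂ h₃ r)
      ⟨VOA.contragredientOperatorMap_injective h₁ h₂ h₃ r,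
        VOA.contragredientOperatorMap_surjective h₁ h₂ h₃ r⟩, fun _ => rfl⟩
  · exact (LinearEquiv.ofBijective (VOA.contragredientOperatorMap h₁ h₂ h₃ r)
      ⟨VOA.contragredientOperatorMap_injective h₁ h₂ h₃ r,
        VOA.contragredientOperatorMap_surjective h₁ h₂ h₃ r⟩).rank_eq
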